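/- **Models.** A *metric stream* of a metric $w$ on $n$ points is a finite sequence of entries $(\{u,v\},w(u,v))$, $u\ne v$, in arbitrary order, in which every pair of distinct points appears at least once. A *randomized $p$-pass streaming algorithm with $S$ bits of space* reads the stream $p$ times in the same order, keeps $S$ bits of memory, may use fresh random coins at every step (neither the coins, nor the time, nor a clock is charged), and finally outputs a real number computed from its memory. It is an *$\alpha$-approximation with error $\delta$* for a class of metrics if, on every metric stream of every metric $w$ in the class, its output $Y$ satisfies $Y\le \mathsf{MST}(w)\le \alpha Y$ with probability at least $1-\delta$, where $\mathsf{MST}(w)$ is the minimum cost of a spanning tree on the $n$ points. In the *Clique or Independent Set* problem $\mathsf{COI}_{N,m}$ on a vertex set $V$ with $|V|=Nm$, each of $k$ players $P_i$ holds sets $R'_i\subseteq R_i$ of unordered pairs of vertices ($R_i$: the pairs whose status the player knows; $R'_i$: those among them that are edges). An input is valid if every pair of distinct vertices lies in some $R_i$ and no pair in $R_i\cap R_j$ lies in $R'_i\setminus R'_j$. The players must answer Yes if the input is valid and the graph with edge set $\bigcup_i R'_i$ is a disjoint union of $m$ cliques of size $N$, and No if the input is valid and the graph is a disjoint union of $m-1$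 cliques of size $N$ and an independent set of size $N$; on all other inputs every answer is correct. In the *blackboard model* the players write bits on a board visible to all; the contents of the board determine who writes next, and at the end determine the answer. Coins may be private or shared. The communication complexity of a protocol is the maximum number of bits written, over all inputs and coins. **Theorem.** 1. There is an absolute constant $\kappa\in\mathbb N$ such that for every $0<\delta<1/2$ there is $c>0$, depending only on $\delta$, such that for all reals $\alpha>1$ and all integers $n\ge 2$, $p\ge 1$: every randomized $p$-pass streaming algorithm that is an $\alpha$-approximation of the MST cost with error $\delta$ for metric streams of metrics on $n$ points uses $$S\;\ge\; \frac{c}{(\log n)^{\kappa}}\sqrt{\frac{n}{\alpha p^2}}$$ bits of space, that is, $\tilde\Omega(\sqrt{n/(\alpha p^2)})$. This holds even if the algorithm is only required to succeed on metrics all of whose distances are integers between $1$ and $\alpha n$. 2. For every $0<\delta<1/2$ there is $c>0$, depending only on $\delta$, such that for all integers $N\ge 2$ and $m\ge 1$, every randomized blackboard protocol for $\mathsf{COI}_{N,m}$ with $\lfloor 2\log_2 N\rfloor$ players that errs with probability at most $\delta$ on every input has communication complexity at least $c\,m/\log_2^3 N$. -/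

import Mathlib

open MeasureTheory

/-! ### Blackboard communication -/

/-- A deterministic `k`-player blackboard protocol in which every player holds an input from `X`.
What has been written on the board so far (a node of the tree) determines which player writes the
next bit, and that player computes the bit from its own input.  At a leaf the contents of the
board determine the output. -/
inductive BoardProtocol (k : ℕ) (X : Type) : Type where
  | leaf (answer : Bool) : BoardProtocol k X
  | node (speaker : Fin k) (msg : X → Bool) (next : Bool → BoardProtocol k X) : BoardProtocol k X

namespace BoardProtocol

variable {k : ℕ} {X : Type}

/-- The output of the protocol when player `i` holds `x i`. -/
def output : BoardProtocol k X → (Fin k → X) → Bool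
  | leaf answer, _ => answer
  | node speaker msg next, x => output (next (msg (x speaker))) x

/-- The number of bits written on the board when player `i` holds `x i`. -/
def bits : BoardProtocol k X → (Fin k → X) → ℕ
  | leaf _, _ => 0
  | node speaker msg next, x => bits (next (msg (x speaker))) x + 1

end BoardProtocol

/-- A randomized blackboard protocol: a random deterministic protocol.  The sample point `ω` may
carry private coins of the individual players as well as coins shared by all of them. -/
structure RandBoardProtocol (k : ℕ) (X : Type) where
  Ω : Type
  [mΩ : MeasurableSpace Ω]
  P : Measure Ω
  [prob : IsProbabilityMeasure P]
  prot : Ω → BoardProtocol k X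
  measurable_output : ∀ x : Fin k → X, Measurable fun ω => (prot ω).output x

/-- At most `C` bits are written on the board, on every input and for every outcome of the
coins. -/
def RandBoardProtocol.CommAtMost {k : ℕ} {X : Type} (π : RandBoardProtocol k X) (C : ℕ) : Prop :=
  ∀ (ω : π.Ω) (x : Fin k → X), (π.prot ω).bits x ≤ C

/-! ### Clique or independent set -/

/-- The input of one player: the set of pairs of vertices about which the player is informed, and
the subset of those pairs that are edges. -/
structure PairInfo (V : Type) where
  known : Set (Sym2 V)
  edges : Set (Sym2 V)
  edges_subset : edges ⊆ known

/-- The graph whose edges are all pairs that some player knows to be an edge. -/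
def boardGraph {k : ℕ} {V : Type} (x : Fin k → PairInfo V) : SimpleGraph V :=
  SimpleGraph.fromEdgeSet (⋃ i, (x i).edges)

/-- Every pair of distinct vertices is known to some player, and any two players agree on the
pairs that both of them know. -/
def IsValidInfo {k : ℕ} {V : Type} (x : Fin k → PairInfo V) : Prop :=
  (∀ e : Sym2 V, ¬ e.IsDiag → ∃ i, e ∈ (x i).known) ∧
  ∀ i j, ∀ e ∈ (x i).known ∩ (x j).known, e ∈ (x i).edges → e ∈ (x j).edges

/-- `G` is a disjoint union of `m` cliques of size `N` each. -/
def IsCliqueUnion {V : Type} (N m : ℕ) (G : SimpleGraph V) : Prop :=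
  ∃ group : V → Fin m, (∀ a, {v | group v = a}.ncard = N) ∧
    ∀ u v, G.Adj u v ↔ u ≠ v ∧ group u = group v

/-- `G` is a disjoint union of `m - 1` cliques of size `N` each and an independent set of
size `N`. -/
def IsCliqueUnionWithIndep {V : Type} (N m : ℕ) (G : SimpleGraph V) : Prop :=
  ∃ (group : V → Fin m) (special : Fin m), (∀ a, {v | group v = a}.ncard = N) ∧
    ∀ u v, G.Adj u v ↔ u ≠ v ∧ group u = group v ∧ group u ≠ special

/-- `answer` is a correct answer to the clique-or-independent-set problem on input `x`;
any answer is correct if the input is not valid or the graph is of neither kind. -/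
def COICorrect (N m : ℕ) {k : ℕ} (x : Fin k → PairInfo (Fin m × Fin N)) (answer : Bool) : Prop :=
  IsValidInfo x →
    (IsCliqueUnion N m (boardGraph x) → answer = true) ∧
    (IsCliqueUnionWithIndep N m (boardGraph x) → answer = false)

/-- The randomized protocol `π` errs with probability at most `δ` on every input of the
clique-or-independent-set problem. -/
def SolvesCOI (N m : ℕ) {k : ℕ} (δ : ℝ) (π : RandBoardProtocol k (PairInfo (Fin m × Fin N))) :
    Prop :=
  letI := π.mΩ
  ∀ x : Fin k → PairInfo (Fin m × Fin N),
    1 - δ ≤ π.P.real {ω | COICorrect N m x ((π.prot ω).output x)}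

/-! ### Finite metrics, minimum spanning trees and metric streams -/

/-- `w` is a metric on `V`; it is written as a function of unordered pairs. -/
structure IsMetricWeight {V : Type} (w : Sym2 V → ℝ) : Prop where
  self : ∀ u, w s(u, u) = 0
  pos : ∀ u v, u ≠ v → 0 < w s(u, v)
  triangle : ∀ u v t, w s(u, t) ≤ w s(u, v) + w s(v, t)

open Classical in
/-- The cost of a minimum spanning tree of the complete graph on `V` with edge weights `w`. -/
noncomputable def mstCost {V : Type} [Fintype V] (w : Sym2 V → ℝ) : ℝ :=
  ⨅ T : {T : SimpleGraph V // T.IsTree}, ∑ e ∈ T.1.edgeFinset, w e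

/-- An entry of a stream: a pair of points and its distance. -/
abbrev StreamItem (n : ℕ) : Type := Sym2 (Fin n) × ℝ

/-- `s` presents the metric `w`: it consists of entries of `w`, in any order, and the distance of
every pair of distinct points appears at least once. -/
def IsMetricStream {n : ℕ} (w : Sym2 (Fin n) → ℝ) (s : List (StreamItem n)) : Prop :=
  (∀ x ∈ s, ¬ x.1.IsDiag ∧ x.2 = w x.1) ∧ ∀ e, ¬ e.IsDiag → (e, w e) ∈ s

/-! ### Streaming algorithms -/

/-- A deterministic streaming algorithm with `S` bits of memory.  On reading an entry it replaces
its memory by `step j t M x`, where `j` is the number of completed passes, `t` the number of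
entries already read in the current pass, `M` the present contents of the memory, and `x` the
entry; at the end it computes its estimate from its memory.  Time per step is not restricted. -/
structure StreamAlg (n S : ℕ) where
  init : Fin S → Bool
  step : ℕ → ℕ → (Fin S → Bool) → StreamItem n → (Fin S → Bool)
  result : (Fin S → Bool) → ℝ

namespace StreamAlg

variable {n S : ℕ}

/-- The contents of the memory after the given number of passes over the stream `s`. -/
def memAfter (A : StreamAlg n S) (s : List (StreamItem n)) : ℕ → (Fin S → Bool)
  | 0 => A.init
  | j + 1 => s.zipIdx.foldl (fun M x => A.step j x.2 M x.1) (A.memAfter s j)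

/-- The estimate after `p` passes over the stream `s`. -/
def output (A : StreamAlg n S) (p : ℕ) (s : List (StreamItem n)) : ℝ :=
  A.result (A.memAfter s p)

end StreamAlg

/-- A randomized streaming algorithm with `S` bits of memory: a random deterministic one.  The
coins are not charged to the memory, and since the steps of the algorithm may depend on the time,
fresh coins may be used at every step. -/
structure RandStreamAlg (n S : ℕ) where
  Ω : Type
  [mΩ : MeasurableSpace Ω]
  P : Measure Ω
  [prob : IsProbabilityMeasure P]
  alg : Ω → StreamAlg n S
  measurable_output : ∀ (p : ℕ) (s : List (StreamItem n)), Measurable fun ω => (alg ω).output p s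

/-- With `p` passes over any metric stream of any metric on `n` points whose distances are integers
between `1` and `α n`, the algorithm returns, with probability at least `1 - δ`, an estimate `Y`
with `Y ≤ MST ≤ α Y`. -/
def RandStreamAlg.ApproximatesMST {n S : ℕ} (A : RandStreamAlg n S) (p : ℕ) (α δ : ℝ) : Prop :=
  letI := A.mΩ
  ∀ w : Sym2 (Fin n) → ℝ, IsMetricWeight w →
    (∀ e, ¬ e.IsDiag → ∃ a : ℕ, 1 ≤ a ∧ (a : ℝ) ≤ α * n ∧ w e = a) →
    ∀ s : List (StreamItem n), IsMetricStream w s →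
      1 - δ ≤ A.P.real {ω | (A.alg ω).output p s ≤ mstCost w ∧
        mstCost w ≤ α * (A.alg ω).output p s}

/-! The streaming bound reduces to the blackboard bound. Give points of the same clique distance 1
and all other pairs distance `W = ⌊α n⌋`. With `m` cliques a spanning tree of cost at most `n - 1 +
(m + 1) W` exists, whereas an independent set of size `N` forces cost `(N - 1) W`; for `N` slightly
above `2 α m` an `α`-approximation separates the two cases. If `k` players write the memory on the
board after each of their pieces of the stream, `p` passes cost `p k S` bits. Taking `m` of order
`√(n / α)` and `k` of order `log N` gives the claim.

For the blackboard bound, pair the blocks into gadgets. In a Yes gadget the vertices `(false, j)`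
and `(true, j)` may be exchanged for some `j`. In the No gadget the fact that the first block is
empty is shared out: player `j + 1` only knows that vertices differing in binary digit `j` are not
adjacent. Each share alone is also true of a Yes gadget, the one flipped along digit `j`.
Transcripts define rectangles, so the Hellinger distance of two transcript distributions is
unchanged when the two inputs exchange one player's value (`dist_gadgetVec_swap`). This cut and
paste bounds the distance from Yes to No by the distances within `2 k` pairs of Yes tuples, each
pair differing in one player (`dist_chain_le`).

Now put a random pair into every gadget and let a random bit choose its tuple; all these inputs are
Yes instances. By the level-one inequality, the squared Hellinger distances caused by the single
bits sum to at most `4 log` of the number of transcripts (`sum_sq_hellinger_le`). A correct protocol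
must distinguish Yes from No in every gadget, so Cauchy–Schwarz over the pairs gives `m = O(k² C)`
(`direct_sum_bound`). -/

/-! ### Rectangle property of blackboard protocols -/

namespace BoardProtocol

variable {k : ℕ} {X : Type}

/-- A number that encodes the final contents of the board. -/
def code : BoardProtocol k X → (Fin k → X) → ℕ
  | leaf _, _ => 0
  | node speaker msg next, x =>
      2 * code (next (msg (x speaker))) x + (if msg (x speaker) then 2 else 1)

/-- The digits are 1 and 2 rather than 0 and 1, so that 0 is left for the empty board and short
boards are not confused with long ones. -/
theorem code_add_two_le (π : BoardProtocol k X) (x : Fin k → X) :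
    π.code x + 2 ≤ 2 ^ (π.bits x + 1) := by
  induction π with
  | leaf b => simp [code, bits]
  | node s msg next ih =>
    have := ih (msg (x s))
    simp only [code, bits]
    rw [pow_succ]
    split_ifs <;> omega

theorem output_eq_of_code_eq (π : BoardProtocol k X) {x y : Fin k → X}
    (h : π.code x = π.code y) : π.output x = π.output y := by
  induction π with
  | leaf b => rfl
  | node s msg next ih =>
    simp only [code] at h
    simp only [output]
    cases hx : msg (x s) <;> cases hy : msg (y s) <;> simp only [hx, hy] at h ⊢ <;>
      simp at h <;> first | exact ih _ h | omega

/-- The runs on `x` and `y` visit the same nodes. At each of them the speaker's value in `z` comes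
from `x` or from `y`, and both produce the same bit. -/
theorem code_eq_of_mix (π : BoardProtocol k X) {x y z : Fin k → X}
    (h : π.code x = π.code y) (hz : ∀ i, z i = x i ∨ z i = y i) : π.code z = π.code x := by
  induction π with
  | leaf b => rfl
  | node s msg next ih =>
    simp only [code] at h ⊢
    have hs : msg (x s) = msg (y s) ∧
        code (next (msg (x s))) x = code (next (msg (x s))) y := by
      cases hx : msg (x s) <;> cases hy : msg (y s) <;> simp only [hx, hy] at h ⊢ <;>
        simp at h ⊢ <;> first | exact h | omega
    have hzs : msg (z s) = msg (x s) := by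
      rcases hz s with h' | h' <;> rw [h']
      exact hs.1.symm
    rw [hzs, ih _ hs.2]

end BoardProtocol

/-! ### The level-one inequality on the cube -/

section Cube

variable {ι : Type} [Fintype ι] [DecidableEq ι]

/-- The sign of a bit. -/
def bitSign (b : Bool) : ℝ := if b then 1 else -1

theorem sum_exp_signs_le (b : ι → ℝ) :
    ∑ x : ι → Bool, Real.exp (∑ g, b g * bitSign (x g)) ≤
      (2 : ℝ) ^ Fintype.card ι * Real.exp ((∑ g, b g ^ 2) / 2) := by
  have h1 : ∑ x : ι → Bool, Real.exp (∑ g, b g * bitSign (x g)) =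
      ∏ g, ∑ c : Bool, Real.exp (b g * bitSign c) := by
    rw [Finset.prod_univ_sum, Fintype.piFinset_univ]
    simp only [Real.exp_sum]
  rw [h1, Finset.sum_div, Real.exp_sum, ← Finset.card_univ, ← Finset.prod_const,
    ← Finset.prod_mul_distrib]
  refine Finset.prod_le_prod (fun g _ => by positivity) fun g _ => ?_
  have := Real.cosh_le_exp_half_sq (b g)
  rw [Real.cosh_eq] at this
  simp only [Fintype.sum_bool, bitSign]
  simp
  linarith

/-- Let `b` be the vector of biases and `B` its squared length, which is the mean over `A` of the
linear form with coefficients `b`. By Jensen, `exp B` is at most the mean of the exponential over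
`A`, hence at most `2 ^ n / |A|` times its mean over the cube, and that mean is at most `exp (B /
2)`. -/
theorem level_one_inequality (A : Finset (ι → Bool)) (hA : A.Nonempty) :
    ∑ g, ((∑ x ∈ A, bitSign (x g)) / (A.card : ℝ)) ^ 2 ≤
      2 * Real.log ((2 : ℝ) ^ Fintype.card ι / A.card) := by
  have hc : (0 : ℝ) < A.card := by exact_mod_cast hA.card_pos
  set b : ι → ℝ := fun g => (∑ x ∈ A, bitSign (x g)) / (A.card : ℝ) with hb
  set B := ∑ g, b g ^ 2 with hB
  have h1 : Real.exp B ≤ (2 : ℝ) ^ Fintype.card ι / A.card * Real.exp (B / 2) := by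
    have hj := convexOn_exp.map_sum_le (t := A) (w := fun _ => (A.card : ℝ)⁻¹)
      (p := fun x => ∑ g, b g * bitSign (x g)) (fun _ _ => by positivity)
      (by simp [hc.ne']) (fun _ _ => Set.mem_univ _)
    simp only [smul_eq_mul, ← Finset.mul_sum] at hj
    have h2 : (A.card : ℝ)⁻¹ * ∑ x ∈ A, ∑ g, b g * bitSign (x g) = B := by
      rw [Finset.sum_comm, Finset.mul_sum]
      refine Finset.sum_congr rfl fun g _ => ?_
      rw [← Finset.mul_sum, hb]
      field_simp
    rw [h2] at hj
    refine hj.trans ?_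
    rw [div_mul_eq_mul_div, le_div_iff₀ hc, mul_comm, ← mul_assoc, mul_inv_cancel₀ hc.ne', one_mul]
    exact (Finset.sum_le_univ_sum_of_nonneg fun _ => (Real.exp_pos _).le).trans
      (sum_exp_signs_le b)
  have h3 := Real.log_le_log (Real.exp_pos _) h1
  rw [Real.log_mul (by positivity) (Real.exp_pos _).ne', Real.log_exp, Real.log_exp] at h3
  linarith

theorem sq_sqrt_sub_sqrt_le {p q : ℝ} (hp : 0 ≤ p) (hq : 0 ≤ q) :
    (√p - √q) ^ 2 * (p + q) ≤ (p - q) ^ 2 := by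
  have h : p - q = (√p - √q) * (√p + √q) := by
    have := Real.sq_sqrt hp
    have := Real.sq_sqrt hq
    nlinarith
  have h2 : p + q ≤ (√p + √q) ^ 2 := by
    have := Real.sq_sqrt hp
    have := Real.sq_sqrt hq
    nlinarith [mul_nonneg (Real.sqrt_nonneg p) (Real.sqrt_nonneg q)]
  rw [h, mul_pow]
  gcongr

/-- The left side ignores the bit `x g`, so each point with `x g = c` is counted twice. -/
theorem card_filter_update {L : Type} [DecidableEq L] (f : (ι → Bool) → L) (g : ι) (c : Bool)
    (l : L) :
    (Finset.univ.filter fun x : ι → Bool => f (Function.update x g c) = l).card =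
      2 * (Finset.univ.filter fun x : ι → Bool => f x = l ∧ x g = c).card := by
  have h1 : (Finset.univ.filter fun x : ι → Bool => f (Function.update x g c) = l ∧ x g = c).card =
      (Finset.univ.filter fun x : ι → Bool => f x = l ∧ x g = c).card := by
    congr 1
    ext x
    simp only [Finset.mem_filter, Finset.mem_univ, true_and]
    refine and_congr_left fun h => ?_
    rw [← h, Function.update_eq_self]
  have h2 : (Finset.univ.filter fun x : ι → Bool =>
        f (Function.update x g c) = l ∧ ¬ x g = c).card =
      (Finset.univ.filter fun x : ι → Bool => f (Function.update x g c) = l ∧ x g = c).card := by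
    refine Finset.card_bij' (fun x _ => Function.update x g (!x g))
      (fun x _ => Function.update x g (!x g)) ?_ ?_ ?_ ?_
    · intro x hx
      simp only [Finset.mem_filter, Finset.mem_univ, true_and] at hx ⊢
      refine ⟨by simpa using hx.1, ?_⟩
      have := hx.2
      cases c <;> simp_all
    · intro x hx
      simp only [Finset.mem_filter, Finset.mem_univ, true_and] at hx ⊢
      refine ⟨by simpa using hx.1, ?_⟩
      have := hx.2
      cases c <;> simp_all
    · intro x _; simp
    · intro x _; simp
  rw [← Finset.card_filter_add_card_filter_not (fun x : ι → Bool => x g = c),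
    Finset.filter_filter, Finset.filter_filter, h2, h1]
  ring

/-- On a level set `A` of `f` the Hellinger term of coordinate `g` is at most `2 |A| / 2 ^ n` times
the squared bias of that coordinate on `A`. The level-one inequality turns the sum over `g` into `4
(|A| / 2 ^ n) log (2 ^ n / |A|)`, and over all levels this adds up to four times the entropy of `f`.
-/
theorem sum_sq_hellinger_le {L : Type} [Fintype L] [DecidableEq L] [Nonempty L]
    (f : (ι → Bool) → L) :
    ∑ g, ∑ l, (√(((Finset.univ.filter fun x : ι → Bool =>
          f (Function.update x g false) = l).card : ℝ) / 2 ^ Fintype.card ι) -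
        √(((Finset.univ.filter fun x : ι → Bool =>
          f (Function.update x g true) = l).card : ℝ) / 2 ^ Fintype.card ι)) ^ 2 ≤
      4 * Real.log (Fintype.card L) := by
  set n : ℝ := 2 ^ Fintype.card ι with hn
  have hn0 : 0 < n := by positivity
  have hL : (0 : ℝ) < Fintype.card L := by exact_mod_cast Fintype.card_pos
  set A : L → Finset (ι → Bool) := fun l => Finset.univ.filter fun x => f x = l with hA
  have hAsum : ∑ l, ((A l).card : ℝ) = n := by
    rw [← Nat.cast_sum, ← Finset.card_eq_sum_card_fiberwise (fun x _ => by simp)]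
    simp [hn]
  rw [Finset.sum_comm]
  -- The last summand is the price of replacing `log (n / |A|)` by `log |L|` through `log t ≤ t -
  -- 1`; it sums to zero over `l`.
  have key : ∀ l, ∑ g, (√(((Finset.univ.filter fun x : ι → Bool =>
          f (Function.update x g false) = l).card : ℝ) / n) -
        √(((Finset.univ.filter fun x : ι → Bool =>
          f (Function.update x g true) = l).card : ℝ) / n)) ^ 2 ≤
      4 * (((A l).card / n) * Real.log (Fintype.card L) + (1 / Fintype.card L - (A l).card / n)) := by
    intro l
    rcases (A l).eq_empty_or_nonempty with h0 | h0
    · have : ∀ c g, (Finset.univ.filter fun x : ι → Bool =>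
          f (Function.update x g c) = l).card = 0 := by
        intro c g
        rw [Finset.card_eq_zero, Finset.filter_eq_empty_iff]
        intro x _ hx
        have : Function.update x g c ∈ A l := by simp [hA, hx]
        simp [h0] at this
      simp [this, h0]
    · have hc : (0 : ℝ) < (A l).card := by exact_mod_cast h0.card_pos
      have hlev := level_one_inequality (A l) h0
      have hg : ∀ g, (√(((Finset.univ.filter fun x : ι → Bool =>
          f (Function.update x g false) = l).card : ℝ) / n) -
        √(((Finset.univ.filter fun x : ι → Bool =>
          f (Function.update x g true) = l).card : ℝ) / n)) ^ 2 ≤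
          2 * ((A l).card / n) * ((∑ x ∈ A l, bitSign (x g)) / ((A l).card : ℝ)) ^ 2 := by
        intro g
        rw [card_filter_update, card_filter_update]
        set n0 := (Finset.univ.filter fun x : ι → Bool => f x = l ∧ x g = false).card
        set n1 := (Finset.univ.filter fun x : ι → Bool => f x = l ∧ x g = true).card
        have e1 : ((A l).card : ℝ) = n0 + n1 := by
          rw [← Nat.cast_add, ← Finset.card_filter_add_card_filter_not (s := A l)
            (fun x : ι → Bool => x g = false)]
          simp only [hA, Finset.filter_filter, Bool.not_eq_false]
          rfl
        have e2 : ∑ x ∈ A l, bitSign (x g) = n1 - n0 := by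
          rw [← Finset.sum_filter_add_sum_filter_not (A l) (fun x : ι → Bool => x g = false)]
          have s0 : ∑ x ∈ A l with x g = false, bitSign (x g) = -(n0 : ℝ) := by
            rw [Finset.sum_congr rfl (g := fun _ => (-1 : ℝ))
              (fun x hx => by simp [bitSign, (Finset.mem_filter.1 hx).2])]
            simp only [hA, Finset.filter_filter, Finset.sum_const, nsmul_eq_mul, mul_neg, mul_one]
            rfl
          have s1 : ∑ x ∈ A l with ¬ x g = false, bitSign (x g) = (n1 : ℝ) := by
            rw [Finset.sum_congr rfl (g := fun _ => (1 : ℝ))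
              (fun x hx => by
                have := (Finset.mem_filter.1 hx).2
                simp only [Bool.not_eq_false] at this
                simp [bitSign, this])]
            simp only [hA, Finset.filter_filter, Finset.sum_const, nsmul_eq_mul, mul_one,
              Bool.not_eq_false]
            rfl
          rw [s0, s1]; ring
        have h3 := sq_sqrt_sub_sqrt_le (p := ((2 * n0 : ℕ) : ℝ) / n) (q := ((2 * n1 : ℕ) : ℝ) / n)
          (by positivity) (by positivity)
        have h4 : ((2 * n0 : ℕ) : ℝ) / n + ((2 * n1 : ℕ) : ℝ) / n = 2 * (A l).card / n := by
          rw [e1]; push_cast; ring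
        have h5 : ((2 * n0 : ℕ) : ℝ) / n - ((2 * n1 : ℕ) : ℝ) / n =
            - (2 * (∑ x ∈ A l, bitSign (x g)) / n) := by
          rw [e2]; push_cast; ring
        rw [h4, h5, ← le_div_iff₀ (by positivity)] at h3
        refine h3.trans (le_of_eq ?_)
        field_simp
      refine (Finset.sum_le_sum fun g _ => hg g).trans ?_
      rw [← Finset.mul_sum]
      have hlog : Real.log (n / (A l).card) ≤
          Real.log (Fintype.card L) + (n / (A l).card / Fintype.card L - 1) := by
        have h6 := Real.log_le_sub_one_of_pos (x := n / (A l).card / Fintype.card L) (by positivity)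
        rw [Real.log_div (by positivity) hL.ne'] at h6
        linarith
      calc 2 * ((A l).card / n) * ∑ g, ((∑ x ∈ A l, bitSign (x g)) / ((A l).card : ℝ)) ^ 2
          ≤ 2 * ((A l).card / n) * (2 * (Real.log (Fintype.card L) +
            (n / (A l).card / Fintype.card L - 1))) := by
            gcongr
            exact hlev.trans (by linarith)
        _ = _ := by field_simp; ring
  refine (Finset.sum_le_sum fun l _ => key l).trans (le_of_eq ?_)
  rw [← Finset.mul_sum, Finset.sum_add_distrib, Finset.sum_sub_distrib, ← Finset.sum_mul,
    ← Finset.sum_div, hAsum]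
  simp [hn0.ne', hL.ne']

end Cube

/-! ### Direct sum -/

section DirectSum

variable {ι T L E : Type} {k : ℕ} [Fintype ι] [DecidableEq ι] [DecidableEq L]

/-- The probability that `f` takes the value `l` when gadget `g` holds `t` and every other gadget
`h` holds one of the two tuples of the pair `a (D h)`, chosen at random. -/
noncomputable def gadgetProb (f : (ι → Fin k → T) → L) (a : E → Bool → Fin k → T) (D : ι → E)
    (g : ι) (t : Fin k → T) (l : L) : ℝ :=
  ((Finset.univ.filter fun x : ι → Bool =>
    f (Function.update (fun h => a (D h) (x h)) g t) = l).card : ℝ) / 2 ^ Fintype.card ι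

/-- The vector of the square roots of the probabilities `gadgetProb`. -/
noncomputable def gadgetVec (f : (ι → Fin k → T) → L) (a : E → Bool → Fin k → T) (D : ι → E)
    (g : ι) (t : Fin k → T) : EuclideanSpace ℝ L :=
  WithLp.toLp 2 fun l => √(gadgetProb f a D g t l)

/-- `f` has rectangular level sets. -/
def IsRectangular (f : (ι → Fin k → T) → L) : Prop :=
  ∀ s t u, f s = f t → (∀ i, (∀ g, u g i = s g i) ∨ (∀ g, u g i = t g i)) → f u = f s

theorem gadgetProb_nonneg (f : (ι → Fin k → T) → L) (a : E → Bool → Fin k → T) (D : ι → E)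
    (g : ι) (t : Fin k → T) (l : L) : 0 ≤ gadgetProb f a D g t l := by
  unfold gadgetProb; positivity

/-- For fixed `D` the bit of gadget `h` affects only player `P (D h)`, so the players' inputs are
independent. Exchanging between `x` and `y` the bits that belong to player `i` is an involution, and
it amounts to exchanging that player's entire input, which a rectangle tolerates. -/
theorem gadgetProb_mul_swap {f : (ι → Fin k → T) → L} (hf : IsRectangular f)
    {a : E → Bool → Fin k → T} {P : E → Fin k}
    (ha : ∀ e i, i ≠ P e → a e false i = a e true i) (D : ι → E)
    (g : ι) (t s : Fin k → T) (i : Fin k) (l : L) :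
    gadgetProb f a D g t l * gadgetProb f a D g s l =
      gadgetProb f a D g (Function.update t i (s i)) l *
        gadgetProb f a D g (Function.update s i (t i)) l := by
  have ha' : ∀ e i c c', i ≠ P e → a e c i = a e c' i := by
    intro e i c c' h
    cases c <;> cases c' <;> first | rfl | exact ha e i h | exact (ha e i h).symm
  unfold gadgetProb
  rw [div_mul_div_comm, div_mul_div_comm]
  congr 1
  norm_cast
  rw [← Finset.card_product, ← Finset.card_product]
  set mix : (ι → Bool) → (ι → Bool) → ι → Bool :=
    fun x y h => if P (D h) = i then y h else x h with hmix
  have hmm : ∀ x y, mix (mix x y) (mix y x) = x := by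
    intro x y
    funext h
    simp only [hmix]
    split_ifs <;> rfl
  have step : ∀ (t s : Fin k → T) (x y : ι → Bool),
      f (Function.update (fun h => a (D h) (x h)) g t) = l →
      f (Function.update (fun h => a (D h) (y h)) g s) = l →
      f (Function.update (fun h => a (D h) (mix x y h)) g (Function.update t i (s i))) = l := by
    intro t s x y hx hy
    rw [← hx]
    refine hf _ _ _ (hx.trans hy.symm) fun j => ?_
    by_cases hj : j = i
    · right
      intro h
      subst hj
      by_cases hg : h = g
      · subst hg; simp
      · simp only [Function.update_of_ne hg, hmix]
        split_ifs with hP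
        · rfl
        · exact ha' _ _ _ _ (Ne.symm hP)
    · left
      intro h
      by_cases hg : h = g
      · subst hg; simp [Function.update_of_ne hj]
      · simp only [Function.update_of_ne hg, hmix]
        split_ifs with hP
        · exact ha' _ _ _ _ (by rw [hP]; exact hj)
        · rfl
  refine Finset.card_bij' (fun p _ => (mix p.1 p.2, mix p.2 p.1))
    (fun p _ => (mix p.1 p.2, mix p.2 p.1)) ?_ ?_ ?_ ?_
  · rintro ⟨x, y⟩ h
    simp only [Finset.mem_product, Finset.mem_filter, Finset.mem_univ, true_and] at h ⊢
    exact ⟨step _ _ _ _ h.1 h.2, step _ _ _ _ h.2 h.1⟩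
  · rintro ⟨x, y⟩ h
    simp only [Finset.mem_product, Finset.mem_filter, Finset.mem_univ, true_and] at h ⊢
    have h1 := step _ _ _ _ h.1 h.2
    have h2 := step _ _ _ _ h.2 h.1
    simp only [Function.update_self, Function.update_idem, Function.update_eq_self] at h1 h2
    exact ⟨h1, h2⟩
  · rintro ⟨x, y⟩ _; simp [hmm]
  · rintro ⟨x, y⟩ _; simp [hmm]

variable [Fintype L]

theorem sum_gadgetProb (f : (ι → Fin k → T) → L) (a : E → Bool → Fin k → T) (D : ι → E)
    (g : ι) (t : Fin k → T) : ∑ l, gadgetProb f a D g t l = 1 := by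
  unfold gadgetProb
  rw [← Finset.sum_div, ← Nat.cast_sum, ← Finset.card_eq_sum_card_fiberwise (fun x _ => by simp)]
  simp

theorem dist_gadgetVec_sq (f : (ι → Fin k → T) → L) (a : E → Bool → Fin k → T) (D : ι → E)
    (g : ι) (t s : Fin k → T) :
    dist (gadgetVec f a D g t) (gadgetVec f a D g s) ^ 2 =
      ∑ l, (√(gadgetProb f a D g t l) - √(gadgetProb f a D g s l)) ^ 2 := by
  rw [EuclideanSpace.dist_eq, Real.sq_sqrt (by positivity)]
  simp [gadgetVec, Real.dist_eq, sq_abs]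

/-- The vectors have length 1, so their distance depends only on the sum of the square roots of the
products of probabilities, and cut and paste preserves every such product. -/
theorem dist_gadgetVec_swap {f : (ι → Fin k → T) → L} (hf : IsRectangular f)
    {a : E → Bool → Fin k → T} {P : E → Fin k}
    (ha : ∀ e i, i ≠ P e → a e false i = a e true i) (D : ι → E)
    (g : ι) (t s : Fin k → T) (i : Fin k) :
    dist (gadgetVec f a D g t) (gadgetVec f a D g s) =
      dist (gadgetVec f a D g (Function.update t i (s i)))
        (gadgetVec f a D g (Function.update s i (t i))) := by
  have key : ∀ t s, dist (gadgetVec f a D g t) (gadgetVec f a D g s) ^ 2 =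
      2 - 2 * ∑ l, √(gadgetProb f a D g t l * gadgetProb f a D g s l) := by
    intro t s
    rw [dist_gadgetVec_sq]
    have : ∀ l, (√(gadgetProb f a D g t l) - √(gadgetProb f a D g s l)) ^ 2 =
        gadgetProb f a D g t l + gadgetProb f a D g s l -
          2 * √(gadgetProb f a D g t l * gadgetProb f a D g s l) := by
      intro l
      rw [Real.sqrt_mul (gadgetProb_nonneg ..), sub_sq, Real.sq_sqrt (gadgetProb_nonneg ..),
        Real.sq_sqrt (gadgetProb_nonneg ..)]
      ring
    rw [Finset.sum_congr rfl fun l _ => this l, Finset.sum_sub_distrib, Finset.sum_add_distrib,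
      sum_gadgetProb, sum_gadgetProb, ← Finset.mul_sum]
    norm_num
  rw [← sq_eq_sq₀ dist_nonneg dist_nonneg, key, key]
  simp_rw [gadgetProb_mul_swap hf ha D g t s i]

/-- Factor `|p - q| = |√p - √q| (√p + √q)` and apply Cauchy–Schwarz; the second factors have squares
summing to at most 4. -/
theorem sum_abs_gadgetProb_sub_le (f : (ι → Fin k → T) → L) (a : E → Bool → Fin k → T)
    (D : ι → E) (g : ι) (t s : Fin k → T) :
    ∑ l, |gadgetProb f a D g t l - gadgetProb f a D g s l| ≤
      2 * dist (gadgetVec f a D g t) (gadgetVec f a D g s) := by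
  set p := gadgetProb f a D g t
  set q := gadgetProb f a D g s
  have hp : ∀ l, 0 ≤ p l := gadgetProb_nonneg _ _ _ _ _
  have hq : ∀ l, 0 ≤ q l := gadgetProb_nonneg _ _ _ _ _
  have h1 : ∀ l, |p l - q l| = |√(p l) - √(q l)| * (√(p l) + √(q l)) := by
    intro l
    rw [← abs_of_nonneg (by positivity : 0 ≤ √(p l) + √(q l)), ← abs_mul]
    congr 1
    have := Real.sq_sqrt (hp l)
    have := Real.sq_sqrt (hq l)
    nlinarith
  have h2 : (∑ l, |p l - q l|) ^ 2 ≤ (2 * dist (gadgetVec f a D g t) (gadgetVec f a D g s)) ^ 2 := by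
    rw [Finset.sum_congr rfl fun l _ => h1 l]
    refine (Finset.sum_mul_sq_le_sq_mul_sq _ _ _).trans ?_
    rw [mul_pow, dist_gadgetVec_sq, mul_comm]
    simp only [sq_abs]
    refine mul_le_mul_of_nonneg_right ?_ (by positivity)
    calc ∑ l, (√(p l) + √(q l)) ^ 2 ≤ ∑ l, 2 * (p l + q l) := by
          refine Finset.sum_le_sum fun l _ => ?_
          have := Real.sq_sqrt (hp l)
          have := Real.sq_sqrt (hq l)
          nlinarith [sq_nonneg (√(p l) - √(q l))]
      _ = 2 ^ 2 := by
          rw [← Finset.mul_sum, Finset.sum_add_distrib, sum_gadgetProb, sum_gadgetProb]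
          norm_num
  exact le_of_sq_le_sq h2 (by positivity)

/-- The advantage of a test that factors through `f` is at most the statistical distance. -/
theorem card_sub_card_le_sum_abs {f : (ι → Fin k → T) → L} (out : (ι → Fin k → T) → Bool)
    (hout : ∀ s t, f s = f t → out s = out t)
    (a : E → Bool → Fin k → T) (D : ι → E) (g : ι) (t s : Fin k → T) :
    (∑ x : ι → Bool,
      ((if out (Function.update (fun h => a (D h) (x h)) g t) = true then (1 : ℝ) else 0) -
        (if out (Function.update (fun h => a (D h) (x h)) g s) = true then (1 : ℝ) else 0))) /
        2 ^ Fintype.card ι ≤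
      ∑ l, |gadgetProb f a D g t l - gadgetProb f a D g s l| := by
  have h1 : ∀ t, ∑ x : ι → Bool,
      (if out (Function.update (fun h => a (D h) (x h)) g t) = true then (1 : ℝ) else 0) =
      ∑ l, ((Finset.univ.filter fun x : ι → Bool =>
        f (Function.update (fun h => a (D h) (x h)) g t) = l ∧
        out (Function.update (fun h => a (D h) (x h)) g t) = true).card : ℝ) := by
    intro t
    rw [← Finset.sum_filter, Finset.sum_const, nsmul_eq_mul, mul_one, ← Nat.cast_sum]
    congr 1
    rw [Finset.card_eq_sum_card_fiberwise
      (f := fun x => f (Function.update (fun h => a (D h) (x h)) g t))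
      (t := Finset.univ) (fun x _ => by simp)]
    refine Finset.sum_congr rfl fun l _ => ?_
    rw [Finset.filter_filter]
    congr 1
    ext x
    simp [and_comm]
  rw [Finset.sum_sub_distrib, h1, h1, ← Finset.sum_sub_distrib, Finset.sum_div]
  refine Finset.sum_le_sum fun l _ => ?_
  by_cases hl : ∃ u, f u = l ∧ out u = true
  · obtain ⟨u, hu, hu'⟩ := hl
    have h2 : ∀ v, (f v = l ∧ out v = true) ↔ f v = l := fun v =>
      ⟨fun h => h.1, fun h => ⟨h, (hout v u (h.trans hu.symm)).trans hu'⟩⟩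
    simp only [h2]
    refine le_trans (le_of_eq ?_) (le_abs_self _)
    unfold gadgetProb
    ring
  · push Not at hl
    have h2 : ∀ v, ¬ (f v = l ∧ out v = true) := fun v h => hl v h.1 h.2
    simp [h2]

variable [Fintype E]

/-- As `F · e` ignores the value at `g`, that value can play the role of the independent index `e`:
exchanging `D g` with `e` is an involution. -/
theorem sum_sum_update_eq (g : ι) (F : (ι → E) → E → ℝ)
    (hF : ∀ D e e', F (Function.update D g e') e = F D e) :
    ∑ D : ι → E, ∑ e, F D e = Fintype.card E * ∑ D : ι → E, F D (D g) := by
  have h1 : ∑ D : ι → E, ∑ e, F D e = ∑ p : (ι → E) × E, F p.1 p.2 := by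
    rw [Fintype.sum_prod_type]
  have h2 : ∑ p : (ι → E) × E, F p.1 p.2 = ∑ p : (ι → E) × E, F p.1 (p.1 g) := by
    refine Finset.sum_bij' (fun p _ => (Function.update p.1 g p.2, p.1 g))
      (fun p _ => (Function.update p.1 g p.2, p.1 g)) ?_ ?_ ?_ ?_ ?_
    · simp
    · simp
    · simp
    · simp
    · intro p _
      simp [hF]
  rw [h1, h2, Fintype.sum_prod_type]
  simp [Finset.mul_sum]

/-- By `sum_sum_update_eq` the tested pair `e` may be taken to be `D g`. For fixed `D` the value of
`f` is then a function of the random bits alone, and `sum_sq_hellinger_le` applies. -/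
theorem sum_dist_sq_le [Nonempty L] (f : (ι → Fin k → T) → L) (a : E → Bool → Fin k → T) :
    ∑ D : ι → E, ∑ g, ∑ e, dist (gadgetVec f a D g (a e false)) (gadgetVec f a D g (a e true)) ^ 2 ≤
      Fintype.card E * ((Fintype.card E : ℝ) ^ Fintype.card ι *
        (4 * Real.log (Fintype.card L))) := by
  rw [Finset.sum_comm]
  have h1 : ∀ g : ι, ∑ D : ι → E, ∑ e,
      dist (gadgetVec f a D g (a e false)) (gadgetVec f a D g (a e true)) ^ 2 =
      Fintype.card E * ∑ D : ι → E,
        dist (gadgetVec f a D g (a (D g) false)) (gadgetVec f a D g (a (D g) true)) ^ 2 := by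
    intro g
    refine sum_sum_update_eq g
      (fun D e => dist (gadgetVec f a D g (a e false)) (gadgetVec f a D g (a e true)) ^ 2)
      fun D e e' => ?_
    have h2 : ∀ t, gadgetVec f a (Function.update D g e') g t = gadgetVec f a D g t := by
      intro t
      unfold gadgetVec gadgetProb
      have : ∀ x : ι → Bool,
          Function.update (fun h => a (Function.update D g e' h) (x h)) g t =
            Function.update (fun h => a (D h) (x h)) g t := by
        intro x
        funext h
        by_cases hg : h = g
        · subst hg; simp
        · simp [Function.update_of_ne hg]
      simp only [this]
    simp only [h2]
  rw [Finset.sum_congr rfl fun g _ => h1 g, ← Finset.mul_sum, Finset.sum_comm]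
  refine mul_le_mul_of_nonneg_left ?_ (by positivity)
  have h3 : ∀ D : ι → E, ∑ g,
      dist (gadgetVec f a D g (a (D g) false)) (gadgetVec f a D g (a (D g) true)) ^ 2 ≤
        4 * Real.log (Fintype.card L) := by
    intro D
    refine le_trans (le_of_eq ?_)
      (sum_sq_hellinger_le fun x : ι → Bool => f fun h => a (D h) (x h))
    refine Finset.sum_congr rfl fun g _ => ?_
    rw [dist_gadgetVec_sq]
    have h4 : ∀ c l, gadgetProb f a D g (a (D g) c) l = ((Finset.univ.filter fun x : ι → Bool =>
        f (fun h => a (D h) (Function.update x g c h)) = l).card : ℝ) / 2 ^ Fintype.card ι := by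
      intro c l
      unfold gadgetProb
      have : ∀ x : ι → Bool, Function.update (fun h => a (D h) (x h)) g (a (D g) c) =
          fun h => a (D h) (Function.update x g c h) := by
        intro x
        funext h
        by_cases hg : h = g
        · subst hg; simp
        · simp [Function.update_of_ne hg]
      simp only [this]
    simp only [h4]
  refine (Finset.sum_le_sum fun D _ => h3 D).trans (le_of_eq ?_)
  simp

/-- Cauchy–Schwarz over all triples `(D, g, e)`. The constant is `64 = (2 * 2) ^ 2 * 4`: one factor
2 from passing to Hellinger distance, one from `hpath`, and the 4 of `sum_dist_sq_le`. -/
theorem direct_sum_bound [Nonempty ι] [Nonempty E] [Nonempty L] {f : (ι → Fin k → T) → L}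
    (a : E → Bool → Fin k → T) {tY tN : Fin k → T}
    (hpath : ∀ D g, dist (gadgetVec f a D g tY) (gadgetVec f a D g tN) ≤
      2 * ∑ e, dist (gadgetVec f a D g (a e false)) (gadgetVec f a D g (a e true)))
    {γ : ℝ} (hγ : 0 ≤ γ)
    (hadv : γ * (Fintype.card ι * (Fintype.card E : ℝ) ^ Fintype.card ι) ≤
      ∑ D : ι → E, ∑ g, ∑ l, |gadgetProb f a D g tY l - gadgetProb f a D g tN l|) :
    γ ^ 2 * Fintype.card ι ≤ 64 * (Fintype.card E : ℝ) ^ 2 * Real.log (Fintype.card L) := by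
  set G : ℝ := ((Fintype.card ι : ℕ) : ℝ) with hG
  set e0 : ℝ := ((Fintype.card E : ℕ) : ℝ) with he0
  set R : ℝ := e0 ^ (Fintype.card ι : ℕ) with hR
  have hGpos : 0 < G := by simp [hG, Fintype.card_pos]
  have hepos : 0 < e0 := by simp [he0, Fintype.card_pos]
  have hRpos : 0 < R := by positivity
  have hsq := sum_dist_sq_le f a
  set d : (ι → E) × ι × E → ℝ := fun p =>
    dist (gadgetVec f a p.1 p.2.1 (a p.2.2 false)) (gadgetVec f a p.1 p.2.1 (a p.2.2 true)) with hd
  have h1 : γ * (G * R) ≤ 4 * ∑ p, d p := by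
    refine hadv.trans ?_
    rw [Fintype.sum_prod_type, Finset.mul_sum]
    refine Finset.sum_le_sum fun D _ => ?_
    rw [Fintype.sum_prod_type, Finset.mul_sum]
    refine Finset.sum_le_sum fun g _ => ?_
    have := sum_abs_gadgetProb_sub_le f a D g tY tN
    have := hpath D g
    simp only [hd]
    linarith
  have h2 : (∑ p, d p) ^ 2 ≤ (R * (G * e0)) * (e0 * (R * (4 * Real.log (Fintype.card L)))) := by
    refine (sq_sum_le_card_mul_sum_sq).trans ?_
    have hcard : ((Finset.univ : Finset ((ι → E) × ι × E)).card : ℝ) = R * (G * e0) := by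
      simp [hR, hG, he0]
    rw [hcard]
    refine mul_le_mul_of_nonneg_left (le_trans (le_of_eq ?_) hsq) (by positivity)
    simp only [Fintype.sum_prod_type, hd]
  have h3 : (γ * (G * R)) ^ 2 ≤ 16 * ((R * (G * e0)) *
      (e0 * (R * (4 * Real.log (Fintype.card L))))) := by
    calc (γ * (G * R)) ^ 2 ≤ (4 * ∑ p, d p) ^ 2 := by gcongr
      _ = 16 * (∑ p, d p) ^ 2 := by ring
      _ ≤ _ := by gcongr
  have h4 : (γ ^ 2 * G) * (G * R ^ 2) ≤
      (64 * e0 ^ 2 * Real.log (Fintype.card L)) * (G * R ^ 2) := by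
    calc _ = (γ * (G * R)) ^ 2 := by ring
      _ ≤ _ := h3
      _ = _ := by ring
  exact le_of_mul_le_mul_right h4 (by positivity)

end DirectSum

/-! ### The chain of Yes tuples -/

section Chain

variable {T : Type} {r : ℕ}

/-- The pairs of tuples that differ in the value of one player; `o`, `F₀`, `Z` are single values,
and `F j`, `X j` are associated with player `j + 1`. -/
def chainPair (o F₀ Z : T) (F X : Fin (r + 1) → T) :
    Option (Fin (r + 1)) × Bool → Bool → Fin (r + 2) → T
  | (some j, false), c => Fin.cons (F j) (Function.update (fun _ => o) j (if c then X j else o))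
  | (some j, true), c => Fin.cons (if c then F j else F₀) fun _ => o
  | (none, false), c => Fin.cons F₀ (Function.update (fun _ => o) 0 (if c then F₀ else o))
  | (none, true), c => Fin.cons (if c then Z else F₀) (Function.update (fun _ => o) 0 F₀)

/-- The player in whose value the two tuples of a pair differ. -/
def chainPlayer : Option (Fin (r + 1)) × Bool → Fin (r + 2)
  | (some j, false) => j.succ
  | (some _, true) => 0
  | (none, false) => Fin.succ 0
  | (none, true) => 0

theorem chainPair_eq_of_ne (o F₀ Z : T) (F X : Fin (r + 1) → T)
    (e : Option (Fin (r + 1)) × Bool) (i : Fin (r + 2)) (hi : i ≠ chainPlayer e) :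
    chainPair o F₀ Z F X e false i = chainPair o F₀ Z F X e true i := by
  revert hi
  refine Fin.cases (fun hi => ?_) (fun i hi => ?_) i
  · rcases e with ⟨_ | j, _ | _⟩ <;> simp_all [chainPair, chainPlayer]
  · rcases e with ⟨_ | j, _ | _⟩ <;>
      simp_all only [chainPair, chainPlayer, ne_eq, Fin.succ_inj, Fin.cons_succ, not_false_eq_true,
        Function.update_of_ne]

/-- Write `(z; p)` for the first player's value and the values of the others, and `O` for the
constant `o`. Exchanging the first player turns `(F₀; O), (Z; X)` into `(Z; O), (F₀; X)`, and both
are compared with `(F₀; O)`. Each `X j` is inserted separately: once `F₀` is replaced by `F j`,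
inserting it is a listed pair. Likewise `Z` replaces `F₀` while the next player holds `F₀`.
Intermediate tuples such as `(F₀; X)` may be contradictory as inputs; only the exchange property of
`v` matters. -/
theorem dist_chain_le {M : Type} [PseudoMetricSpace M] (v : (Fin (r + 2) → T) → M)
    (hv : ∀ t s i, dist (v t) (v s) =
      dist (v (Function.update t i (s i))) (v (Function.update s i (t i))))
    (o F₀ Z : T) (F X : Fin (r + 1) → T) :
    dist (v (Fin.cons F₀ fun _ => o)) (v (Fin.cons Z X)) ≤
      2 * ∑ e, dist (v (chainPair o F₀ Z F X e false)) (v (chainPair o F₀ Z F X e true)) := by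
  have cp0 : ∀ (z z' : T) (p p' : Fin (r + 1) → T),
      dist (v (Fin.cons z p)) (v (Fin.cons z' p')) =
        dist (v (Fin.cons z' p)) (v (Fin.cons z p')) := by
    intro z z' p p'
    rw [hv _ _ 0]
    simp [Fin.update_cons_zero]
  have cps : ∀ (z z' : T) (p p' : Fin (r + 1) → T) (j : Fin (r + 1)),
      dist (v (Fin.cons z p)) (v (Fin.cons z' p')) =
        dist (v (Fin.cons z (Function.update p j (p' j))))
          (v (Fin.cons z' (Function.update p' j (p j)))) := by
    intro z z' p p' j
    rw [hv _ _ j.succ]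
    simp [Fin.cons_update]
  set O : Fin (r + 1) → T := fun _ => o with hO
  set d1 : Fin (r + 1) → ℝ := fun j =>
    dist (v (Fin.cons (F j) O)) (v (Fin.cons (F j) (Function.update O j (X j)))) with hd1
  set d2 : Fin (r + 1) → ℝ := fun j => dist (v (Fin.cons F₀ O)) (v (Fin.cons (F j) O)) with hd2
  set d3 : ℝ := dist (v (Fin.cons F₀ O)) (v (Fin.cons F₀ (Function.update O 0 F₀))) with hd3
  set d4 : ℝ := dist (v (Fin.cons F₀ (Function.update O 0 F₀)))
    (v (Fin.cons Z (Function.update O 0 F₀))) with hd4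
  have hsum : ∑ e, dist (v (chainPair o F₀ Z F X e false)) (v (chainPair o F₀ Z F X e true)) =
      d4 + d3 + ∑ j, (d2 j + d1 j) := by
    have hOo : ∀ j, Function.update O j o = O := fun j => by
      rw [hO]; exact Function.update_eq_self j _
    rw [Fintype.sum_prod_type, Fintype.sum_option]
    simp only [Fintype.sum_bool, chainPair, if_true, Bool.false_eq_true, if_false]
    simp only [← hO, hOo]
    rfl
  have single : ∀ j, dist (v (Fin.cons F₀ (Function.update O j (X j)))) (v (Fin.cons F₀ O)) ≤
      d1 j + 2 * d2 j := by
    intro j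
    have h1 := dist_triangle (v (Fin.cons F₀ (Function.update O j (X j)))) (v (Fin.cons (F j) O))
      (v (Fin.cons F₀ O))
    have h2 := cp0 F₀ (F j) (Function.update O j (X j)) O
    have h3 := dist_triangle (v (Fin.cons (F j) (Function.update O j (X j))))
      (v (Fin.cons (F j) O)) (v (Fin.cons F₀ O))
    have h4 := dist_comm (v (Fin.cons (F j) (Function.update O j (X j)))) (v (Fin.cons (F j) O))
    have h5 := dist_comm (v (Fin.cons (F j) O)) (v (Fin.cons F₀ O))
    simp only [hd1, hd2]
    linarith
  have many : ∀ S : Finset (Fin (r + 1)),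
      dist (v (Fin.cons F₀ fun i => if i ∈ S then X i else o)) (v (Fin.cons F₀ O)) ≤
        ∑ j ∈ S, (d1 j + 2 * d2 j) := by
    intro S
    induction S using Finset.induction_on with
    | empty => simp [hO]
    | insert j S hj ih =>
      -- The exchange moves `X j` to the other tuple, so that the change on `S` and the change at
      -- `j` are each measured from `(F₀; O)`.
      rw [cps _ _ _ _ j, Finset.sum_insert hj]
      have e1 : Function.update (fun i => if i ∈ insert j S then X i else o) j (O j) =
          fun i => if i ∈ S then X i else o := by
        funext i
        by_cases hi : i = j
        · subst hi; simp [hj, hO]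
        · simp [hi]
      rw [e1]
      simp only [Finset.mem_insert_self, if_true]
      have h1 := dist_triangle (v (Fin.cons F₀ fun i => if i ∈ S then X i else o))
        (v (Fin.cons F₀ O)) (v (Fin.cons F₀ (Function.update O j (X j))))
      have h2 := single j
      rw [dist_comm] at h2
      linarith
  have hZ : dist (v (Fin.cons Z O)) (v (Fin.cons F₀ O)) ≤ d4 + 2 * d3 := by
    have h1 := dist_triangle (v (Fin.cons Z O)) (v (Fin.cons F₀ (Function.update O 0 F₀)))
      (v (Fin.cons F₀ O))
    have h2 := cps Z F₀ O (Function.update O 0 F₀) 0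
    have e1 : Function.update (Function.update O 0 F₀) 0 (O 0) = O := by simp
    rw [e1, Function.update_self] at h2
    have h3 := dist_triangle (v (Fin.cons Z (Function.update O 0 F₀)))
      (v (Fin.cons F₀ (Function.update O 0 F₀))) (v (Fin.cons F₀ O))
    have h4 := dist_comm (v (Fin.cons Z (Function.update O 0 F₀)))
      (v (Fin.cons F₀ (Function.update O 0 F₀)))
    have h5 := dist_comm (v (Fin.cons F₀ (Function.update O 0 F₀))) (v (Fin.cons F₀ O))
    simp only [hd3, hd4]
    linarith
  have hall := many Finset.univ
  simp only [Finset.mem_univ, if_true] at hall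
  have h1 := cp0 Z F₀ X O
  have h2 := dist_triangle (v (Fin.cons F₀ X)) (v (Fin.cons F₀ O)) (v (Fin.cons Z O))
  have h3 := dist_comm (v (Fin.cons F₀ O)) (v (Fin.cons Z O))
  have h4 : ∑ j, (d1 j + 2 * d2 j) ≤ 2 * ∑ j, (d2 j + d1 j) := by
    rw [Finset.mul_sum]
    refine Finset.sum_le_sum fun j _ => ?_
    have : 0 ≤ d1 j := dist_nonneg
    linarith
  have h5 : 0 ≤ d4 := dist_nonneg
  rw [dist_comm, hsum]
  linarith

end Chain

/-! ### Inputs assembled from gadgets of two blocks -/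

/-- The player knows the status of the pairs in `K` in the graph with edge set `M`. -/
def PairInfo.restrict {V : Type} (K M : Set (Sym2 V)) : PairInfo V :=
  ⟨K, K ∩ M, Set.inter_subset_left⟩

/-- The inputs `t` are correct partial descriptions of the graph with edge set `M`, and together
they describe all of it. -/
structure FitsGraph {k : ℕ} {V : Type} (M : Set (Sym2 V)) (t : Fin k → PairInfo V) : Prop where
  edges_eq : ∀ i, (t i).edges = (t i).known ∩ M
  cover : ∀ e : Sym2 V, ¬ e.IsDiag → ∃ i, e ∈ (t i).known

theorem FitsGraph.isValidInfo {k : ℕ} {V : Type} {M : Set (Sym2 V)} {t : Fin k → PairInfo V}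
    (h : FitsGraph M t) : IsValidInfo t := by
  refine ⟨h.cover, fun i j e he hi => ?_⟩
  rw [h.edges_eq] at hi ⊢
  exact ⟨he.2, hi.2⟩

theorem FitsGraph.adj_iff {k : ℕ} {V : Type} {M : Set (Sym2 V)} {t : Fin k → PairInfo V}
    (h : FitsGraph M t) (u v : V) : (boardGraph t).Adj u v ↔ u ≠ v ∧ s(u, v) ∈ M := by
  rw [boardGraph, SimpleGraph.fromEdgeSet_adj, Set.mem_iUnion, and_comm]
  refine and_congr_right fun huv => ⟨?_, fun hM => ?_⟩
  · rintro ⟨i, hi⟩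
    rw [h.edges_eq] at hi
    exact hi.2
  · obtain ⟨i, hi⟩ := h.cover s(u, v) (by simpa using huv)
    exact ⟨i, by rw [h.edges_eq]; exact ⟨hi, hM⟩⟩

section Gadget

variable {N m : ℕ}

/-- The index of the pair of blocks that contains `v`. -/
def gadgetIdx (v : Fin m × Fin N) : ℕ := v.1.val / 2

/-- The position of `v` within its pair of blocks. -/
def gadgetPos (v : Fin m × Fin N) : Bool × Fin N := (decide (v.1.val % 2 = 1), v.2)

theorem gadget_ext {u v : Fin m × Fin N} (h1 : gadgetIdx u = gadgetIdx v)
    (h2 : gadgetPos u = gadgetPos v) : u = v := by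
  simp only [gadgetIdx, gadgetPos, Prod.mk.injEq, decide_eq_decide] at h1 h2
  refine Prod.ext (Fin.ext ?_) h2.2
  have := h2.1
  omega

/-- The pairs inside gadget `g` that the set `M g` contains. -/
def assembleSet (m : ℕ) (M : ℕ → Set (Sym2 (Bool × Fin N))) : Set (Sym2 (Fin m × Fin N)) :=
  {e | ∃ g, (∀ v ∈ e, gadgetIdx v = g) ∧ e.map gadgetPos ∈ M g}

theorem mem_assembleSet {M : ℕ → Set (Sym2 (Bool × Fin N))} {u v : Fin m × Fin N} :
    s(u, v) ∈ assembleSet m M ↔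
      gadgetIdx u = gadgetIdx v ∧ s(gadgetPos u, gadgetPos v) ∈ M (gadgetIdx u) := by
  constructor
  · rintro ⟨g, hg, h⟩
    have h1 := hg u (by simp)
    have h2 := hg v (by simp)
    subst h1
    exact ⟨h2.symm, h⟩
  · rintro ⟨h1, h2⟩
    refine ⟨gadgetIdx u, ?_, h2⟩
    intro w hw
    rcases Sym2.mem_iff.1 hw with rfl | rfl
    exacts [rfl, h1.symm]

/-- The input of a player who holds `t g` in gadget `g` and knows that there are no edges between
different gadgets. -/
def assemble (m : ℕ) (t : ℕ → PairInfo (Bool × Fin N)) : PairInfo (Fin m × Fin N) where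
  known := {e | ∀ g, (∀ v ∈ e, gadgetIdx v = g) → e.map gadgetPos ∈ (t g).known}
  edges := assembleSet m fun g => (t g).edges
  edges_subset := by
    intro e
    induction e using Sym2.ind with
    | _ u v =>
      intro he g hg
      have h := (mem_assembleSet.1 he).2
      rw [hg u (by simp)] at h
      exact (t g).edges_subset h

theorem mem_assemble_known {t : ℕ → PairInfo (Bool × Fin N)} {u v : Fin m × Fin N} :
    s(u, v) ∈ (assemble m t).known ↔
      (gadgetIdx u = gadgetIdx v → s(gadgetPos u, gadgetPos v) ∈ (t (gadgetIdx u)).known) := by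
  constructor
  · intro h h1
    refine h _ fun w hw => ?_
    rcases Sym2.mem_iff.1 hw with rfl | rfl
    exacts [rfl, h1.symm]
  · intro h g hg
    have h1 := hg u (by simp)
    have h2 := hg v (by simp)
    subst h1
    exact h h2.symm

theorem FitsGraph.assemble {r : ℕ} {M : ℕ → Set (Sym2 (Bool × Fin N))}
    {t : ℕ → Fin (r + 1) → PairInfo (Bool × Fin N)} (h : ∀ g, FitsGraph (M g) (t g)) :
    FitsGraph (assembleSet m M) fun i => _root_.assemble m fun g => t g i := by
  constructor
  · intro i
    ext e
    induction e using Sym2.ind with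
    | _ u v =>
      rw [Set.mem_inter_iff, mem_assemble_known, mem_assembleSet]
      refine mem_assembleSet.trans ?_
      rw [(h _).edges_eq]
      constructor
      · rintro ⟨h1, h2⟩
        exact ⟨fun _ => h2.1, h1, h2.2⟩
      · rintro ⟨h1, h2, h3⟩
        exact ⟨h2, h1 h2, h3⟩
  · intro e
    induction e using Sym2.ind with
    | _ u v =>
      intro huv
      simp only [mem_assemble_known]
      by_cases hg : gadgetIdx u = gadgetIdx v
      · obtain ⟨i, hi⟩ := (h (gadgetIdx u)).cover s(gadgetPos u, gadgetPos v) (by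
          rw [Sym2.mk_isDiag_iff] at huv ⊢
          exact fun h' => huv (gadget_ext hg h'))
        exact ⟨i, fun _ => hi⟩
      · exact ⟨0, fun h' => absurd h' hg⟩

/-- Vertex `(b, j)` of a gadget belongs to block `b`, or to the other block if `β j` holds. -/
def flipBlock (β : Fin N → Bool) (w : Bool × Fin N) : Bool := xor w.1 (β w.2)

/-- The edges of the two cliques that are given by `flipBlock`. -/
def flipEdges (β : Fin N → Bool) : Set (Sym2 (Bool × Fin N)) :=
  {e | (e.map (flipBlock β)).IsDiag}

/-- The pairs within the first block of a gadget. -/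
def firstBlockPairs (N : ℕ) : Set (Sym2 (Bool × Fin N)) := {e | ∀ w ∈ e, w.1 = false}

theorem mem_flipEdges {β : Fin N → Bool} {u v : Bool × Fin N} :
    s(u, v) ∈ flipEdges β ↔ flipBlock β u = flipBlock β v := by
  simp [flipEdges]

theorem mem_firstBlockPairs {u v : Bool × Fin N} :
    s(u, v) ∈ firstBlockPairs N ↔ u.1 = false ∧ v.1 = false := by
  simp only [firstBlockPairs, Set.mem_ofPred_eq, Sym2.mem_iff, forall_eq_or_imp, forall_eq]

/-- The block of the vertex `v` after the flips `β g` in the gadgets `g`. -/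
def flipGroupVal (β : ℕ → Fin N → Bool) (v : Fin m × Fin N) : ℕ :=
  2 * gadgetIdx v + (flipBlock (β (gadgetIdx v)) (gadgetPos v)).toNat

/-- For odd `m` the last block has no partner; a flip there would create a block with index `m`. -/
theorem flipGroupVal_lt {β : ℕ → Fin N → Bool} (hβ : ∀ g j, m / 2 ≤ g → β g j = false)
    (v : Fin m × Fin N) : flipGroupVal β v < m := by
  have hv := v.1.isLt
  unfold flipGroupVal
  by_cases h : m / 2 ≤ gadgetIdx v
  · have hf : flipBlock (β (gadgetIdx v)) (gadgetPos v) = (gadgetPos v).1 := by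
      simp [flipBlock, hβ _ _ h]
    rw [hf]
    simp only [gadgetPos, gadgetIdx]
    by_cases h1 : v.1.val % 2 = 1 <;> simp [h1] <;> omega
  · have := Bool.toNat_le (flipBlock (β (gadgetIdx v)) (gadgetPos v))
    omega

theorem flipGroupVal_eq_iff {β : ℕ → Fin N → Bool} {u v : Fin m × Fin N} :
    flipGroupVal β u = flipGroupVal β v ↔
      s(u, v) ∈ assembleSet m fun g => flipEdges (β g) := by
  rw [mem_assembleSet, mem_flipEdges]
  unfold flipGroupVal
  constructor
  · intro h
    have h1 := Bool.toNat_le (flipBlock (β (gadgetIdx u)) (gadgetPos u))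
    have h2 := Bool.toNat_le (flipBlock (β (gadgetIdx v)) (gadgetPos v))
    have h3 : gadgetIdx u = gadgetIdx v := by omega
    refine ⟨h3, ?_⟩
    rw [h3] at h ⊢
    have h4 : (flipBlock (β (gadgetIdx v)) (gadgetPos u)).toNat =
        (flipBlock (β (gadgetIdx v)) (gadgetPos v)).toNat := by omega
    revert h4
    cases flipBlock (β (gadgetIdx v)) (gadgetPos u) <;>
      cases flipBlock (β (gadgetIdx v)) (gadgetPos v) <;> simp
  · rintro ⟨h1, h2⟩
    rw [h1] at h2
    rw [h1, h2]

theorem ncard_flipGroup {β : ℕ → Fin N → Bool} (hβ : ∀ g j, m / 2 ≤ g → β g j = false)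
    (a : Fin m) :
    {v : Fin m × Fin N | (⟨flipGroupVal β v, flipGroupVal_lt hβ v⟩ : Fin m) = a}.ncard = N := by
  -- For fixed `j` the flip is an involution on the blocks, so every block receives exactly one
  -- vertex with second coordinate `j`.
  have hinv : ∀ v : Fin m × Fin N, flipGroupVal (m := m) β
      (⟨flipGroupVal β v, flipGroupVal_lt hβ v⟩, v.2) = v.1 := by
    rintro ⟨a, j⟩
    have h1 := Bool.toNat_le (flipBlock (β (a.val / 2)) (decide (a.val % 2 = 1), j))
    have e1 : (2 * (a.val / 2) + (flipBlock (β (a.val / 2))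
        (decide (a.val % 2 = 1), j)).toNat) / 2 = a.val / 2 := by omega
    simp only [flipGroupVal, gadgetIdx, gadgetPos, e1]
    rcases Nat.mod_two_eq_zero_or_one a.val with h | h <;> cases hb : β (a.val / 2) j <;>
      simp [flipBlock, h, hb, Nat.add_mod] <;> omega
  have hset : {v : Fin m × Fin N | (⟨flipGroupVal β v, flipGroupVal_lt hβ v⟩ : Fin m) = a} =
      Set.range fun j : Fin N =>
        ((⟨flipGroupVal β (a, j), flipGroupVal_lt hβ (a, j)⟩ : Fin m), j) := by
    ext v
    simp only [Set.mem_ofPred_eq, Set.mem_range]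
    constructor
    · rintro rfl
      exact ⟨v.2, Prod.ext (Fin.ext (hinv v)) rfl⟩
    · rintro ⟨j, rfl⟩
      exact Fin.ext (hinv (a, j))
  rw [hset, ← Set.image_univ, Set.ncard_image_of_injective _ fun i j h => (Prod.ext_iff.1 h).2]
  simp

theorem FitsGraph.isCliqueUnion {k : ℕ} {β : ℕ → Fin N → Bool}
    (hβ : ∀ g j, m / 2 ≤ g → β g j = false) {x : Fin k → PairInfo (Fin m × Fin N)}
    (hx : FitsGraph (assembleSet m fun g => flipEdges (β g)) x) :
    IsCliqueUnion N m (boardGraph x) := by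
  refine ⟨fun v => ⟨flipGroupVal β v, flipGroupVal_lt hβ v⟩, ncard_flipGroup hβ, fun u v => ?_⟩
  rw [hx.adj_iff, ← flipGroupVal_eq_iff, Fin.mk.injEq]

theorem FitsGraph.isCliqueUnionWithIndep {k : ℕ} {β : ℕ → Fin N → Bool}
    (hβ : ∀ g j, m / 2 ≤ g → β g j = false) {g₀ : ℕ} (hg₀ : g₀ < m / 2)
    (hβ₀ : ∀ j, β g₀ j = false) {x : Fin k → PairInfo (Fin m × Fin N)}
    (hx : FitsGraph (assembleSet m fun g =>
      if g = g₀ then flipEdges (β g) \ firstBlockPairs N else flipEdges (β g)) x) :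
    IsCliqueUnionWithIndep N m (boardGraph x) := by
  -- Gadget `g₀` is not flipped, hence its first block, which loses its edges, is group `2 * g₀`.
  refine ⟨fun v => ⟨flipGroupVal β v, flipGroupVal_lt hβ v⟩, ⟨2 * g₀, by omega⟩,
    ncard_flipGroup hβ, fun u v => ?_⟩
  rw [hx.adj_iff, Fin.mk.injEq, flipGroupVal_eq_iff, mem_assembleSet, mem_assembleSet, and_assoc]
  refine and_congr_right fun _ => and_congr_right fun huv => ?_
  have hval : flipGroupVal β u = 2 * g₀ ↔ gadgetIdx u = g₀ ∧ (gadgetPos u).1 = false := by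
    unfold flipGroupVal
    constructor
    · intro h
      have h1 := Bool.toNat_le (flipBlock (β (gadgetIdx u)) (gadgetPos u))
      have h2 : gadgetIdx u = g₀ := by omega
      refine ⟨h2, ?_⟩
      rw [h2] at h
      simpa [flipBlock, hβ₀] using h
    · rintro ⟨h1, h2⟩
      simp [h1, flipBlock, hβ₀, h2]
  rw [ne_eq, Fin.mk.injEq, hval]
  by_cases hu : gadgetIdx u = g₀
  · simp only [hu, if_true, true_and, Set.mem_sdiff, mem_firstBlockPairs, mem_flipEdges, flipBlock,
      hβ₀, Bool.xor_false]
    refine and_congr_right fun h => ?_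
    rw [← h, and_self]
  · simp [hu]

end Gadget

/-! ### The hard inputs -/

section Hard

variable {N r : ℕ}

/-- The player knows nothing about the gadget. -/
def infoNone (N : ℕ) : PairInfo (Bool × Fin N) := PairInfo.restrict ∅ ∅

/-- The player knows everything about the gadget with flips `β`. -/
def infoFull (β : Fin N → Bool) : PairInfo (Bool × Fin N) :=
  PairInfo.restrict Set.univ (flipEdges β)

/-- The player knows everything about the two blocks of the gadget except the pairs within the
first one. -/
def infoOutside (N : ℕ) : PairInfo (Bool × Fin N) :=
  PairInfo.restrict (firstBlockPairs N)ᶜ (flipEdges fun _ => false)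

/-- The player knows that there are no edges between the two parts of the first block that are
given by `β`. -/
def infoCut (β : Fin N → Bool) : PairInfo (Bool × Fin N) :=
  PairInfo.restrict (firstBlockPairs N ∩ (flipEdges β)ᶜ) ∅

/-- Flips that are given by a binary digit. -/
def bitFlip (N j : ℕ) (i : Fin N) : Bool := i.val.testBit j

/-- The pairs of tuples between which the hard inputs choose. -/
def hardPair (N r : ℕ) (e : Option (Fin (r + 1)) × Bool) (c : Bool) :
    Fin (r + 2) → PairInfo (Bool × Fin N) :=
  chainPair (infoNone N) (infoFull fun _ => false) (infoOutside N)
    (fun j => infoFull (bitFlip N j)) (fun j => infoCut (bitFlip N j)) e c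

/-- The tuple of a gadget with two cliques. -/
def hardYes (N r : ℕ) : Fin (r + 2) → PairInfo (Bool × Fin N) :=
  Fin.cons (infoFull fun _ => false) fun _ => infoNone N

/-- The tuple of a gadget with an independent set. -/
def hardNo (N r : ℕ) : Fin (r + 2) → PairInfo (Bool × Fin N) :=
  Fin.cons (infoOutside N) fun j => infoCut (bitFlip N j)

theorem FitsGraph.of_full {k : ℕ} {β : Fin N → Bool} {t : Fin k → PairInfo (Bool × Fin N)}
    (h : ∀ i, (t i).edges = (t i).known ∩ flipEdges β) (i : Fin k) (hi : t i = infoFull β) :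
    FitsGraph (flipEdges β) t :=
  ⟨h, fun e _ => ⟨i, by rw [hi]; exact Set.mem_univ e⟩⟩

theorem infoNone_edges (M : Set (Sym2 (Bool × Fin N))) :
    (infoNone N).edges = (infoNone N).known ∩ M := by
  simp [infoNone, PairInfo.restrict]

theorem infoFull_edges (β : Fin N → Bool) :
    (infoFull β).edges = (infoFull β).known ∩ flipEdges β := rfl

theorem infoOutside_edges :
    (infoOutside N).edges = (infoOutside N).known ∩ flipEdges fun _ => false := rfl

/-- Vertices of the first block that `β` separates lie in different cliques after the flip. The cut
is therefore true of this Yes graph as well as of the graph whose first block is independent. -/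
theorem infoCut_edges (β : Fin N → Bool) :
    (infoCut β).edges = (infoCut β).known ∩ flipEdges β := by
  ext e
  simp only [infoCut, PairInfo.restrict, Set.mem_inter_iff, Set.mem_compl_iff,
    Set.mem_empty_iff_false]
  tauto

theorem hardYes_fits (N r : ℕ) : FitsGraph (flipEdges fun _ => false) (hardYes N r) := by
  refine FitsGraph.of_full (fun i => ?_) 0 rfl
  refine Fin.cases (infoFull_edges _) (fun i => infoNone_edges _) i

/-- In every tuple some player knows a whole Yes graph, and what the others hold is true of it: the
cut along digit `j` occurs with the flip along digit `j`, and `infoOutside` with the unflipped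
graph. -/
theorem hardPair_fits (e : Option (Fin (r + 1)) × Bool) (c : Bool) :
    ∃ β, FitsGraph (flipEdges β) (hardPair N r e c) := by
  rcases e with ⟨_ | j, _ | _⟩
  · refine ⟨fun _ => false, FitsGraph.of_full (fun i => ?_) 0 rfl⟩
    refine Fin.cases (infoFull_edges _) (fun i => ?_) i
    simp only [hardPair, chainPair, Fin.cons_succ, Function.update_apply]
    split_ifs <;> first | exact infoFull_edges _ | exact infoNone_edges _
  · refine ⟨fun _ => false, FitsGraph.of_full (fun i => ?_) (Fin.succ 0) rfl⟩
    refine Fin.cases ?_ (fun i => ?_) i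
    · simp only [hardPair, chainPair, Fin.cons_zero]
      split_ifs
      exacts [infoOutside_edges, infoFull_edges _]
    · simp only [hardPair, chainPair, Fin.cons_succ, Function.update_apply]
      split_ifs <;> first | exact infoFull_edges _ | exact infoNone_edges _
  · refine ⟨bitFlip N j, FitsGraph.of_full (fun i => ?_) 0 rfl⟩
    refine Fin.cases (infoFull_edges _) (fun i => ?_) i
    simp only [hardPair, chainPair, Fin.cons_succ, Function.update_apply]
    split_ifs <;> first | exact infoCut_edges _ | exact infoNone_edges _
  · cases c
    · exact ⟨fun _ => false, FitsGraph.of_full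
        (Fin.cases (infoFull_edges _) fun i => infoNone_edges _) 0 rfl⟩
    · exact ⟨bitFlip N j, FitsGraph.of_full
        (Fin.cases (infoFull_edges _) fun i => infoNone_edges _) 0 rfl⟩

/-- The shares cover the first block because two distinct numbers below `2 ^ (r + 1)` differ in one
of the digits `0, …, r`. -/
theorem hardNo_fits (hN : N ≤ 2 ^ (r + 1)) :
    FitsGraph ((flipEdges fun _ => false) \ firstBlockPairs N) (hardNo N r) := by
  constructor
  · intro i
    refine Fin.cases ?_ (fun j => ?_) i
    · ext e
      simp only [hardNo, Fin.cons_zero, infoOutside, PairInfo.restrict, Set.mem_inter_iff,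
        Set.mem_compl_iff, Set.mem_sdiff]
      tauto
    · ext e
      simp only [hardNo, Fin.cons_succ, infoCut, PairInfo.restrict, Set.mem_inter_iff,
        Set.mem_compl_iff, Set.mem_sdiff, Set.mem_empty_iff_false]
      tauto
  · intro e he
    by_cases h : e ∈ firstBlockPairs N
    · induction e using Sym2.ind with
      | _ u v =>
        obtain ⟨hu, hv⟩ := mem_firstBlockPairs.1 h
        have huv : u.2.val ≠ v.2.val := by
          intro h'
          exact he ((Sym2.mk_isDiag_iff).2 (Prod.ext (hu.trans hv.symm) (Fin.ext h')))
        obtain ⟨j, hj⟩ : ∃ j, u.2.val.testBit j ≠ v.2.val.testBit j := by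
          by_contra! hc
          exact huv (Nat.eq_of_testBit_eq hc)
        have hjr : j < r + 1 := by
          by_contra! hc
          have hlt : ∀ w : Fin N, w.val.testBit j = false := fun w =>
            Nat.testBit_lt_two_pow ((w.isLt.trans_le hN).trans_le
              (Nat.pow_le_pow_right (by norm_num) hc))
          exact hj ((hlt _).trans (hlt _).symm)
        refine ⟨Fin.succ ⟨j, hjr⟩, h, ?_⟩
        simp only [Set.mem_compl_iff, mem_flipEdges, flipBlock, hu, hv, bitFlip, Bool.false_xor]
        exact hj
    · exact ⟨0, h⟩

/-- The global inputs of the players that hold `u g` in gadget `g`; a block that is left over is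
known to everyone. -/
def globalInput {k : ℕ} (m : ℕ) (u : Fin (m / 2) → Fin k → PairInfo (Bool × Fin N)) :
    Fin k → PairInfo (Fin m × Fin N) :=
  fun i => assemble m fun g => if h : g < m / 2 then u ⟨g, h⟩ i else infoFull fun _ => false

theorem globalInput_fits {k m : ℕ} {u : Fin (m / 2) → Fin (k + 1) → PairInfo (Bool × Fin N)}
    {M : ℕ → Set (Sym2 (Bool × Fin N))} (hu : ∀ g, FitsGraph (M g.val) (u g))
    (hM : ∀ g, m / 2 ≤ g → M g = flipEdges fun _ => false) :
    FitsGraph (assembleSet m M) (globalInput m u) := by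
  have h : FitsGraph (assembleSet m M) fun i => assemble m fun g =>
      (fun g i => if h : g < m / 2 then u ⟨g, h⟩ i else infoFull fun _ => false) g i := by
    refine FitsGraph.assemble fun g => ?_
    by_cases hg : g < m / 2
    · simpa [hg] using hu ⟨g, hg⟩
    · simp only [hg, dite_false]
      rw [hM g (not_lt.1 hg)]
      exact FitsGraph.of_full (fun _ => infoFull_edges _) 0 rfl
  exact h

theorem globalInput_hardYes {m : ℕ} {D : Fin (m / 2) → Option (Fin (r + 1)) × Bool}
    {x : Fin (m / 2) → Bool} {g₀ : Fin (m / 2)} :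
    let y := globalInput m (Function.update (fun g => hardPair N r (D g) (x g)) g₀ (hardYes N r))
    IsValidInfo y ∧ IsCliqueUnion N m (boardGraph y) := by
  choose β hβ using fun g => hardPair_fits (N := N) (r := r) (D g) (x g)
  set β' : ℕ → Fin N → Bool := fun g =>
    if h : g < m / 2 then Function.update β g₀ (fun _ => false) ⟨g, h⟩ else fun _ => false with hβ'
  have hβ0 : ∀ g, m / 2 ≤ g → β' g = fun _ => false := fun g hg => by
    simp [hβ', not_lt.2 hg]
  have hfit : FitsGraph (assembleSet m fun g => flipEdges (β' g))
      (globalInput m (Function.update (fun g => hardPair N r (D g) (x g)) g₀ (hardYes N r))) := by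
    refine globalInput_fits (fun g => ?_) fun g hg => by rw [hβ0 g hg]
    simp only [hβ', g.isLt, dite_true, Fin.eta]
    by_cases hg : g = g₀
    · subst hg
      simpa using hardYes_fits N r
    · simpa [Function.update_of_ne hg] using hβ g
  exact ⟨hfit.isValidInfo, hfit.isCliqueUnion fun g j hg => by rw [hβ0 g hg]⟩

theorem globalInput_hardNo (hN : N ≤ 2 ^ (r + 1)) {m : ℕ}
    {D : Fin (m / 2) → Option (Fin (r + 1)) × Bool}
    {x : Fin (m / 2) → Bool} {g₀ : Fin (m / 2)} :
    let y := globalInput m (Function.update (fun g => hardPair N r (D g) (x g)) g₀ (hardNo N r))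
    IsValidInfo y ∧ IsCliqueUnionWithIndep N m (boardGraph y) := by
  choose β hβ using fun g => hardPair_fits (N := N) (r := r) (D g) (x g)
  set β' : ℕ → Fin N → Bool := fun g =>
    if h : g < m / 2 then Function.update β g₀ (fun _ => false) ⟨g, h⟩ else fun _ => false with hβ'
  have hβ0 : ∀ g, m / 2 ≤ g → β' g = fun _ => false := fun g hg => by
    simp [hβ', not_lt.2 hg]
  have hβ1 : β' g₀ = fun _ => false := by simp [hβ']
  have hfit : FitsGraph (assembleSet m fun g =>
      if g = g₀.val then flipEdges (β' g) \ firstBlockPairs N else flipEdges (β' g))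
      (globalInput m (Function.update (fun g => hardPair N r (D g) (x g)) g₀ (hardNo N r))) := by
    refine globalInput_fits (fun g => ?_) fun g hg => ?_
    · by_cases hg : g = g₀
      · subst hg
        simpa [hβ1] using hardNo_fits hN
      · have hg' : g.val ≠ g₀.val := fun h => hg (Fin.ext h)
        simp only [hg', if_false, hβ', g.isLt, dite_true, Fin.eta]
        simpa [Function.update_of_ne hg] using hβ g
    · have := g₀.isLt
      rw [if_neg (by omega), hβ0 g hg]
  exact ⟨hfit.isValidInfo, hfit.isCliqueUnionWithIndep (fun g j hg => by rw [hβ0 g hg]) g₀.isLt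
    fun j => by rw [hβ1]⟩

end Hard

/-! ### The communication lower bound -/

/-- Each difference has expectation at least `1 - 2 * δ`, so some outcome of the coins does at least
as well in the sum. This fixes the coins for all inputs in `J` simultaneously. -/
theorem exists_sum_le_sum_indicator {Ω J : Type} [MeasurableSpace Ω] (P : Measure Ω)
    [IsProbabilityMeasure P] [Fintype J] (y n : J → Ω → Bool) (hy : ∀ j, Measurable (y j))
    (hn : ∀ j, Measurable (n j)) (δ : ℝ) (hyP : ∀ j, 1 - δ ≤ P.real {ω | y j ω = true})
    (hnP : ∀ j, 1 - δ ≤ P.real {ω | n j ω = false}) :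
    ∃ ω, (1 - 2 * δ) * Fintype.card J ≤
      ∑ j, ((if y j ω = true then (1 : ℝ) else 0) - (if n j ω = true then (1 : ℝ) else 0)) := by
  have hm : ∀ z : Ω → Bool, Measurable z → MeasurableSet {ω | z ω = true} := fun z hz =>
    hz (measurableSet_singleton true)
  have hi : ∀ z : Ω → Bool, Measurable z →
      Integrable (fun ω => if z ω = true then (1 : ℝ) else 0) P := fun z hz => by
    refine ((integrable_const (μ := P) (1 : ℝ)).indicator (hm z hz)).congr
      (ae_of_all _ fun ω => ?_)
    simp [Set.indicator_apply]
  have hint : ∀ z : Ω → Bool, Measurable z →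
      ∫ ω, (if z ω = true then (1 : ℝ) else 0) ∂P = P.real {ω | z ω = true} := fun z hz => by
    rw [← integral_indicator_one (hm z hz)]
    refine integral_congr_ae (ae_of_all _ fun ω => ?_)
    simp [Set.indicator_apply]
  have hsub : ∀ j, Integrable (fun ω => (if y j ω = true then (1 : ℝ) else 0) -
      (if n j ω = true then (1 : ℝ) else 0)) P := fun j => (hi _ (hy j)).sub (hi _ (hn j))
  obtain ⟨ω, hω⟩ := exists_integral_le (μ := P) (f := fun ω => ∑ j,
      ((if y j ω = true then (1 : ℝ) else 0) - (if n j ω = true then (1 : ℝ) else 0)))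
    (integrable_finsetSum _ fun j _ => hsub j)
  refine ⟨ω, le_trans ?_ hω⟩
  rw [integral_finsetSum _ fun j _ => hsub j]
  have hj : ∀ j, 1 - 2 * δ ≤ ∫ ω, ((if y j ω = true then (1 : ℝ) else 0) -
      (if n j ω = true then (1 : ℝ) else 0)) ∂P := by
    intro j
    rw [integral_sub (hi _ (hy j)) (hi _ (hn j)), hint _ (hy j), hint _ (hn j)]
    have h1 : P.real {ω | n j ω = true} = 1 - P.real {ω | n j ω = false} := by
      rw [← probReal_compl_eq_one_sub (s := {ω | n j ω = false})
        (hn j (measurableSet_singleton false))]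
      congr 1
      ext ω
      simp
    have := hyP j
    have := hnP j
    linarith
  calc (1 - 2 * δ) * Fintype.card J = ∑ _j : J, (1 - 2 * δ) := by
        rw [Finset.sum_const, nsmul_eq_mul, Finset.card_univ, mul_comm]
    _ ≤ _ := Finset.sum_le_sum fun j _ => hj j

theorem coi_lower_bound {N m r C : ℕ} (hN : N ≤ 2 ^ (r + 1)) (hm : 2 ≤ m) {δ : ℝ} (hδ : δ < 1 / 2)
    (π : RandBoardProtocol (r + 2) (PairInfo (Fin m × Fin N))) (hπ : SolvesCOI N m δ π)
    (hC : π.CommAtMost C) :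
    (1 - 2 * δ) ^ 2 * ((m / 2 : ℕ) : ℝ) ≤
      64 * (2 * ((r : ℝ) + 2)) ^ 2 * ((C + 1) * Real.log 2) := by
  let _ := π.mΩ
  have := π.prob
  have : Nonempty (Fin (m / 2)) := ⟨⟨0, by omega⟩⟩
  -- A pair for every gadget, the tested gadget, and a bit for every gadget. The pair and the bit of
  -- the tested gadget are overwritten, but keeping them makes `J` match the sums in
  -- `direct_sum_bound`.
  let J := (Fin (m / 2) → Option (Fin (r + 1)) × Bool) × Fin (m / 2) × (Fin (m / 2) → Bool)
  let inp : (Fin (r + 2) → PairInfo (Bool × Fin N)) → J →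
      Fin (r + 2) → PairInfo (Fin m × Fin N) := fun t j =>
    globalInput m (Function.update (fun g => hardPair N r (j.1 g) (j.2.2 g)) j.2.1 t)
  obtain ⟨ω, hω⟩ := exists_sum_le_sum_indicator (J := J) π.P
    (fun j ω => (π.prot ω).output (inp (hardYes N r) j))
    (fun j ω => (π.prot ω).output (inp (hardNo N r) j))
    (fun j => π.measurable_output _) (fun j => π.measurable_output _) δ
    (fun j => (hπ (inp (hardYes N r) j)).trans (measureReal_mono fun ω h =>
      (h globalInput_hardYes.1).1 globalInput_hardYes.2))
    (fun j => (hπ (inp (hardNo N r) j)).trans (measureReal_mono fun ω h =>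
      (h (globalInput_hardNo hN).1).2 (globalInput_hardNo hN).2))
  -- With the coins fixed, `f` is the final board; boards of at most `C` bits have codes below `2 ^
  -- (C + 1)`.
  set f : (Fin (m / 2) → Fin (r + 2) → PairInfo (Bool × Fin N)) → Fin (2 ^ (C + 1)) := fun u =>
    ⟨(π.prot ω).code (globalInput m u), by
      have h1 := (π.prot ω).code_add_two_le (globalInput m u)
      have h2 := Nat.pow_le_pow_right (n := 2) (by norm_num)
        (Nat.add_le_add_right (hC ω (globalInput m u)) 1)
      omega⟩ with hf
  have hrect : IsRectangular f := by
    intro s t u hst hu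
    rw [hf, Fin.mk.injEq] at hst
    rw [hf, Fin.mk.injEq]
    refine (π.prot ω).code_eq_of_mix hst fun i => ?_
    rcases hu i with h | h
    · left; simp only [globalInput, h]
    · right; simp only [globalInput, h]
  have hout : ∀ s t, f s = f t →
      (π.prot ω).output (globalInput m s) = (π.prot ω).output (globalInput m t) := by
    intro s t hst
    rw [hf, Fin.mk.injEq] at hst
    exact (π.prot ω).output_eq_of_code_eq hst
  have hmain := direct_sum_bound (f := f) (hardPair N r) (tY := hardYes N r) (tN := hardNo N r)
    (fun D g => dist_chain_le _ (fun t s i => dist_gadgetVec_swap hrect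
      (chainPair_eq_of_ne _ _ _ _ _) D g t s i) _ _ _ _ _)
    (γ := 1 - 2 * δ) (by linarith) (by
      have h2 : (0 : ℝ) < 2 ^ Fintype.card (Fin (m / 2)) := by positivity
      have hle := fun (D : Fin (m / 2) → Option (Fin (r + 1)) × Bool) g =>
        card_sub_card_le_sum_abs (f := f) (fun u => (π.prot ω).output (globalInput m u)) hout (hardPair N r) D g
          (hardYes N r) (hardNo N r)
      refine le_trans ?_ (Finset.sum_le_sum fun D _ => Finset.sum_le_sum fun g _ => hle D g)
      simp only [← Finset.sum_div]
      rw [le_div_iff₀ h2]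
      refine le_trans (le_of_eq ?_) (hω.trans (le_of_eq ?_))
      · have hJ : Fintype.card J = Fintype.card (Option (Fin (r + 1)) × Bool) ^
            Fintype.card (Fin (m / 2)) *
              (Fintype.card (Fin (m / 2)) * 2 ^ Fintype.card (Fin (m / 2))) := by
          rw [Fintype.card_prod, Fintype.card_prod, Fintype.card_fun, Fintype.card_fun,
            Fintype.card_bool]
        rw [hJ]
        push_cast
        ring
      · simp only [J, inp, Fintype.sum_prod_type])
  have hE : (Fintype.card (Option (Fin (r + 1)) × Bool) : ℝ) = 2 * ((r : ℝ) + 2) := by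
    simp
    ring
  rw [hE, Fintype.card_fin, Fintype.card_fin] at hmain
  push_cast at hmain
  rw [Real.log_pow] at hmain
  push_cast at hmain
  exact hmain

/-- Without any bit the answer is constant, yet there are valid Yes and No inputs in which everyone
knows everything. This covers `m = 1`, where there is no gadget, and allows `C + 1 ≤ 2 * C`. -/
theorem one_le_of_solvesCOI {N m k C : ℕ} (hm : 1 ≤ m) (hk : 1 ≤ k) {δ : ℝ} (hδ : δ < 1 / 2)
    (π : RandBoardProtocol k (PairInfo (Fin m × Fin N))) (hπ : SolvesCOI N m δ π)
    (hC : π.CommAtMost C) : 1 ≤ C := by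
  by_contra! hC0
  obtain rfl : C = 0 := by omega
  let _ := π.mΩ
  have := π.prob
  have hfit : ∀ M : Set (Sym2 (Fin m × Fin N)),
      FitsGraph M fun _ : Fin k => PairInfo.restrict Set.univ M := fun M =>
    ⟨fun _ => rfl, fun e _ => ⟨⟨0, hk⟩, Set.mem_univ e⟩⟩
  have hcard : ∀ a : Fin m, {v : Fin m × Fin N | v.1 = a}.ncard = N := by
    intro a
    have : {v : Fin m × Fin N | v.1 = a} = Set.range fun j : Fin N => (a, j) := by
      ext ⟨b, j⟩
      simp [eq_comm]
    rw [this, ← Set.image_univ, Set.ncard_image_of_injective _ (Prod.mk_right_injective a)]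
    simp
  set MY : Set (Sym2 (Fin m × Fin N)) := {e | (e.map Prod.fst).IsDiag} with hMY
  set MN : Set (Sym2 (Fin m × Fin N)) :=
    {e | (e.map Prod.fst).IsDiag ∧ ∀ v ∈ e, v.1 ≠ ⟨0, hm⟩} with hMN
  have hY : IsCliqueUnion N m
      (boardGraph fun _ : Fin k => PairInfo.restrict Set.univ MY) := by
    refine ⟨Prod.fst, hcard, fun u v => ?_⟩
    rw [(hfit MY).adj_iff]
    simp [hMY]
  have hNo : IsCliqueUnionWithIndep N m
      (boardGraph fun _ : Fin k => PairInfo.restrict Set.univ MN) := by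
    refine ⟨Prod.fst, ⟨0, hm⟩, hcard, fun u v => ?_⟩
    rw [(hfit MN).adj_iff]
    simp only [hMN, Set.mem_ofPred_eq, Sym2.map_mk, Sym2.mk_isDiag_iff, Sym2.mem_iff,
      forall_eq_or_imp, forall_eq]
    refine and_congr_right fun _ => and_congr_right fun h => ?_
    rw [← h, and_self]
  obtain ⟨ω, hω⟩ := exists_sum_le_sum_indicator (J := Unit) π.P
    (fun _ ω => (π.prot ω).output fun _ => PairInfo.restrict Set.univ MY)
    (fun _ ω => (π.prot ω).output fun _ => PairInfo.restrict Set.univ MN)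
    (fun _ => π.measurable_output _) (fun _ => π.measurable_output _) δ
    (fun _ => (hπ _).trans (measureReal_mono fun ω h => (h (hfit MY).isValidInfo).1 hY))
    (fun _ => (hπ _).trans (measureReal_mono fun ω h => (h (hfit MN).isValidInfo).2 hNo))
  have hconst : ∀ x y, (π.prot ω).output x = (π.prot ω).output y := by
    intro x y
    have h0 := hC ω x
    cases hp : π.prot ω with
    | leaf b => rfl
    | node s msg next =>
      rw [hp] at h0
      simp [BoardProtocol.bits] at h0
  rw [hconst _ fun _ => PairInfo.restrict Set.univ MN] at hω
  simp at hω
  linarith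

/-- `6144 = 64 * 16 * 2 * 3`: the square of `2 * (2 * l)` gives 16, `C + 1 ≤ 2 * C` gives 2, and `m
≤ 3 * (m / 2)` gives 3. The argument yields `l ^ 2`, which is weakened to `l ^ 3`. -/
theorem coi_communication_bound {N m k C : ℕ} {l δ : ℝ} (hk : (k : ℝ) ≤ 2 * l) (hl : 1 ≤ l)
    (hN : 2 ≤ N) (hNk : 2 * N ≤ 2 ^ k) (hm : 1 ≤ m) (hδ0 : 0 < δ) (hδ : δ < 1 / 2)
    (π : RandBoardProtocol k (PairInfo (Fin m × Fin N))) (hπ : SolvesCOI N m δ π)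
    (hC : π.CommAtMost C) : (1 - 2 * δ) ^ 2 / 6144 * m / l ^ 3 ≤ C := by
  have hk2 : 2 ≤ k := by
    by_contra! h
    have : 2 ^ k ≤ 2 ^ 1 := Nat.pow_le_pow_right (by norm_num) (by omega)
    omega
  obtain ⟨r, rfl⟩ : ∃ r, k = r + 2 := ⟨k - 2, by omega⟩
  have hC1 : 1 ≤ C := one_le_of_solvesCOI hm (by omega) hδ π hπ hC
  have hC1' : (1 : ℝ) ≤ C := by exact_mod_cast hC1
  have hγ : (1 - 2 * δ) ^ 2 ≤ 1 := by nlinarith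
  have hl3 : 1 ≤ l ^ 3 := one_le_pow₀ hl
  rw [div_le_iff₀ (by positivity)]
  rcases hm.eq_or_lt with rfl | hm2
  · push_cast
    nlinarith
  · have hmain := coi_lower_bound (r := r) (by rw [pow_succ] at hNk; omega) hm2 hδ π hπ hC
    have hfl : (m : ℝ) ≤ 3 * ((m / 2 : ℕ) : ℝ) := by
      have : m ≤ 3 * (m / 2) := by omega
      exact_mod_cast this
    push_cast at hk
    have hlog : Real.log 2 ≤ 1 := by linarith [Real.log_two_lt_d9]
    have hlog0 : 0 ≤ Real.log 2 := by linarith [Real.log_two_gt_d9]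
    have h1 : 64 * (2 * ((r : ℝ) + 2)) ^ 2 * ((C + 1) * Real.log 2) ≤
        64 * (2 * (2 * l)) ^ 2 * ((C + C) * 1) := by gcongr
    have h2 : (C : ℝ) * l ^ 2 ≤ C * l ^ 3 := by
      gcongr
      norm_num
    have h3 : (1 - 2 * δ) ^ 2 * m ≤ (1 - 2 * δ) ^ 2 * (3 * ((m / 2 : ℕ) : ℝ)) := by gcongr
    nlinarith

/-- The factor 2 is needed since one of the `k` players is not assigned a digit. Rounding gives `N ^
2 < 2 ^ (k + 1)`, which suffices for `4 ≤ N`; for `N = 2` and `N = 3` the exponent is bounded by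
hand. -/
theorem two_mul_le_two_pow_floor {N : ℕ} (hN : 2 ≤ N) :
    2 * N ≤ 2 ^ ⌊2 * Real.logb 2 N⌋₊ := by
  set k := ⌊2 * Real.logb 2 N⌋₊ with hk
  have hN0 : (0 : ℝ) < N := by positivity
  have h1 : N ^ 2 < 2 ^ (k + 1) := by
    have h2 := Nat.lt_floor_add_one (2 * Real.logb 2 N)
    rw [← hk] at h2
    have h3 : (2 : ℝ) ^ (2 * Real.logb 2 N) < 2 ^ ((k : ℝ) + 1) :=
      Real.rpow_lt_rpow_of_exponent_lt (by norm_num) h2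
    rw [mul_comm, Real.rpow_mul (by norm_num),
      Real.rpow_logb (by norm_num) (by norm_num) hN0] at h3
    have h4 : ((N ^ 2 : ℕ) : ℝ) < ((2 ^ (k + 1) : ℕ) : ℝ) := by
      push_cast
      rw [← Real.rpow_natCast, ← Real.rpow_natCast]
      push_cast
      exact h3
    exact_mod_cast h4
  rcases lt_or_ge N 4 with h | h
  · have h5 : 3 ≤ k + 1 := by
      by_contra! h6
      have : 2 ^ (k + 1) ≤ 2 ^ 2 := Nat.pow_le_pow_right (by norm_num) (by omega)
      interval_cases N <;> omega
    interval_cases N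
    · have : 2 ^ 2 ≤ 2 ^ k := Nat.pow_le_pow_right (by norm_num) (by omega)
      omega
    · have h6 : 3 ≤ k := by
        by_contra! h7
        have : 2 ^ (k + 1) ≤ 2 ^ 3 := Nat.pow_le_pow_right (by norm_num) (by omega)
        omega
      have : 2 ^ 3 ≤ 2 ^ k := Nat.pow_le_pow_right (by norm_num) h6
      omega
  · rw [pow_succ 2 k, sq] at h1
    nlinarith

theorem one_le_logb_two {N : ℕ} (hN : 2 ≤ N) : 1 ≤ Real.logb 2 N := by
  rw [Real.le_logb_iff_rpow_le (by norm_num) (by positivity), Real.rpow_one]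
  exact_mod_cast hN

theorem coi_communication {N m C : ℕ} {δ : ℝ} (hδ0 : 0 < δ) (hδ : δ < 1 / 2) (hN : 2 ≤ N)
    (hm : 1 ≤ m) (π : RandBoardProtocol ⌊2 * Real.logb 2 N⌋₊ (PairInfo (Fin m × Fin N)))
    (hπ : SolvesCOI N m δ π) (hC : π.CommAtMost C) :
    (1 - 2 * δ) ^ 2 / 6144 * m / Real.logb 2 N ^ 3 ≤ C := by
  have hl := one_le_logb_two hN
  exact coi_communication_bound (Nat.floor_le (by positivity)) hl hN
    (two_mul_le_two_pow_floor hN) hm hδ0 hδ π hπ hC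

/-! ### Simulating a streaming algorithm on the blackboard -/

namespace BoardProtocol

variable {k : ℕ} {X : Type}

/-- Player `i` writes the `S` bits `f x` on the board, and the protocol goes on with `next`. -/
def broadcast (i : Fin k) : (S : ℕ) → (X → Fin S → Bool) →
    ((Fin S → Bool) → BoardProtocol k X) → BoardProtocol k X
  | 0, _, next => next Fin.elim0
  | S + 1, f, next => node i (fun x => f x 0) fun b =>
      broadcast i S (fun x j => f x j.succ) fun M => next (Fin.cons b M)

theorem output_broadcast (i : Fin k) (S : ℕ) (f : X → Fin S → Bool)
    (next : (Fin S → Bool) → BoardProtocol k X) (x : Fin k → X) :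
    (broadcast i S f next).output x = (next (f (x i))).output x := by
  induction S with
  | zero => rw [broadcast, Subsingleton.elim Fin.elim0 (f (x i))]
  | succ S ih =>
    rw [broadcast, output, ih]
    congr 2
    exact Fin.cons_self_tail _

theorem bits_broadcast (i : Fin k) (S : ℕ) (f : X → Fin S → Bool)
    (next : (Fin S → Bool) → BoardProtocol k X) (x : Fin k → X) :
    (broadcast i S f next).bits x = S + (next (f (x i))).bits x := by
  induction S with
  | zero => rw [broadcast, Subsingleton.elim Fin.elim0 (f (x i)), zero_add]
  | succ S ih =>
    rw [broadcast, bits, ih, add_right_comm]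
    congr 3
    exact Fin.cons_self_tail _

/-- The players named in the list update a memory of `S` bits one after the other, and write it on
the board each time. -/
def relay {S : ℕ} (final : (Fin S → Bool) → Bool) :
    List (Fin k × ((Fin S → Bool) → X → (Fin S → Bool))) → (Fin S → Bool) → BoardProtocol k X
  | [], M => leaf (final M)
  | q :: l, M => broadcast q.1 S (q.2 M) fun M' => relay final l M'

theorem output_relay {S : ℕ} (final : (Fin S → Bool) → Bool)
    (l : List (Fin k × ((Fin S → Bool) → X → (Fin S → Bool)))) (M : Fin S → Bool)
    (x : Fin k → X) :
    (relay final l M).output x = final (l.foldl (fun M q => q.2 M (x q.1)) M) := by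
  induction l generalizing M with
  | nil => rfl
  | cons q l ih => rw [relay, output_broadcast, ih, List.foldl_cons]

theorem bits_relay {S : ℕ} (final : (Fin S → Bool) → Bool)
    (l : List (Fin k × ((Fin S → Bool) → X → (Fin S → Bool)))) (M : Fin S → Bool)
    (x : Fin k → X) : (relay final l M).bits x = l.length * S := by
  induction l generalizing M with
  | nil => simp [relay, bits]
  | cons q l ih => rw [relay, bits_broadcast, ih, List.length_cons]; ring

end BoardProtocol

namespace StreamAlg

variable {n S k : ℕ} {X : Type}

/-- The updates of the memory in pass `j` when the players in the list append their pieces of the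
stream, each of length `b`, after `off` entries. -/
def passRounds (A : StreamAlg n S) (piece : X → List (StreamItem n)) (b j : ℕ) :
    List (Fin k) → ℕ → List (Fin k × ((Fin S → Bool) → X → (Fin S → Bool)))
  | [], _ => []
  | i :: l, off => (i, fun M y => ((piece y).zipIdx off).foldl (fun M x => A.step j x.2 M x.1) M) ::
      passRounds A piece b j l (off + b)

/-- The updates of the memory in the first `p` passes. -/
def rounds (A : StreamAlg n S) (piece : X → List (StreamItem n)) (b : ℕ) :
    ℕ → List (Fin k × ((Fin S → Bool) → X → (Fin S → Bool)))
  | 0 => []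
  | p + 1 => rounds A piece b p ++ passRounds A piece b p (List.finRange k) 0

theorem length_passRounds (A : StreamAlg n S) (piece : X → List (StreamItem n)) (b j : ℕ)
    (l : List (Fin k)) (off : ℕ) : (A.passRounds piece b j l off).length = l.length := by
  induction l generalizing off with
  | nil => rfl
  | cons i l ih => simp [passRounds, ih]

theorem length_rounds (A : StreamAlg n S) (piece : X → List (StreamItem n)) (b p : ℕ) :
    (A.rounds (k := k) piece b p).length = p * k := by
  induction p with
  | zero => simp [rounds]
  | succ p ih => simp [rounds, ih, length_passRounds, add_mul]

/-- Steps may depend on the time. Since all pieces have the same length `b`, a player knows the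
number of entries before its own piece without seeing the other inputs. -/
theorem foldl_passRounds (A : StreamAlg n S) {piece : X → List (StreamItem n)} {b : ℕ}
    (hb : ∀ y, (piece y).length = b) (j : ℕ) (x : Fin k → X) (l : List (Fin k)) (off : ℕ)
    (M : Fin S → Bool) :
    (A.passRounds piece b j l off).foldl (fun M q => q.2 M (x q.1)) M =
      ((l.flatMap fun i => piece (x i)).zipIdx off).foldl (fun M y => A.step j y.2 M y.1) M := by
  induction l generalizing off M with
  | nil => rfl
  | cons i l ih =>
    rw [passRounds, List.foldl_cons, ih, List.flatMap_cons, List.zipIdx_append, List.foldl_append,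
      hb]

theorem foldl_rounds (A : StreamAlg n S) {piece : X → List (StreamItem n)} {b : ℕ}
    (hb : ∀ y, (piece y).length = b) (x : Fin k → X) (p : ℕ) :
    (A.rounds piece b p).foldl (fun M q => q.2 M (x q.1)) A.init =
      A.memAfter ((List.finRange k).flatMap fun i => piece (x i)) p := by
  induction p with
  | zero => rfl
  | succ p ih => rw [rounds, List.foldl_append, ih, foldl_passRounds A hb, memAfter]

end StreamAlg

theorem RandStreamAlg.exists_protocol {n S k : ℕ} {X : Type} (A : RandStreamAlg n S) (p : ℕ)
    (thr : ℝ) (piece : X → List (StreamItem n)) {b : ℕ} (hb : ∀ y, (piece y).length = b) :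
    ∃ prot : A.Ω → BoardProtocol k X,
      (∀ ω x, (prot ω).bits x = p * k * S) ∧
      ∀ ω x, (prot ω).output x =
        decide ((A.alg ω).output p ((List.finRange k).flatMap fun i => piece (x i)) ≤ thr) := by
  refine ⟨fun ω => BoardProtocol.relay (fun M => decide ((A.alg ω).result M ≤ thr))
    ((A.alg ω).rounds piece b p) (A.alg ω).init, fun ω x => ?_, fun ω x => ?_⟩
  · rw [BoardProtocol.bits_relay, StreamAlg.length_rounds]
  · rw [BoardProtocol.output_relay, StreamAlg.foldl_rounds _ hb]
    rfl

/-! ### Bounds on the cost of a minimum spanning tree -/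

/-- Contracting a spanning tree along `q` leaves a connected graph on `Q`, with at least `|Q| - 1`
edges, and these come from distinct tree edges between different classes. -/
theorem le_mstCost {V Q : Type} [Fintype V] [Nonempty V] [Fintype Q] {w : Sym2 V → ℝ} {q : V → Q}
    (hq : Function.Surjective q) (hw : ∀ e, 0 ≤ w e) {W : ℝ} (hW0 : 0 ≤ W)
    (hW : ∀ u v, q u ≠ q v → W ≤ w s(u, v)) : ((Fintype.card Q : ℝ) - 1) * W ≤ mstCost w := by
  classical
  have hne : Nonempty {T : SimpleGraph V // T.IsTree} := by
    obtain ⟨T, -, hT⟩ := (SimpleGraph.connected_top (V := V)).exists_isTree_le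
    exact ⟨T, hT⟩
  refine le_ciInf fun T => ?_
  set H : SimpleGraph Q := SimpleGraph.fromEdgeSet (Sym2.map q '' T.1.edgeSet) with hH
  have hreach : ∀ u v, T.1.Reachable u v → H.Reachable (q u) (q v) := by
    rintro u v ⟨p⟩
    induction p with
    | nil => exact SimpleGraph.Reachable.refl _
    | @cons a c d hac p ih =>
      refine SimpleGraph.Reachable.trans ?_ ih
      by_cases hqe : q a = q c
      · rw [hqe]
      · refine SimpleGraph.Adj.reachable ?_
        rw [hH, SimpleGraph.fromEdgeSet_adj]
        exact ⟨⟨s(a, c), hac, rfl⟩, hqe⟩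
  have hconn : H.Connected := by
    have : Nonempty Q := (‹Nonempty V›).map q
    refine ⟨fun a b => ?_⟩
    obtain ⟨u, rfl⟩ := hq a
    obtain ⟨v, rfl⟩ := hq b
    exact hreach u v (T.2.connected.preconnected u v)
  have h1 := hconn.card_vert_le_card_edgeSet_add_one
  rw [Nat.card_eq_fintype_card, Nat.card_eq_fintype_card, ← SimpleGraph.edgeFinset_card] at h1
  set F := T.1.edgeFinset.filter fun e => ¬ (e.map q).IsDiag with hF
  have h2 : H.edgeFinset.card ≤ F.card := by
    refine (Finset.card_le_card fun e he => ?_).trans (Finset.card_image_le (f := Sym2.map q))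
    rw [SimpleGraph.mem_edgeFinset, hH, SimpleGraph.edgeSet_fromEdgeSet] at he
    obtain ⟨⟨e', he', rfl⟩, hd⟩ := he
    refine Finset.mem_image_of_mem _ (Finset.mem_filter.2 ⟨?_, hd⟩)
    rwa [SimpleGraph.mem_edgeFinset]
  have h3 : (Fintype.card Q : ℝ) - 1 ≤ F.card := by
    have : (Fintype.card Q : ℝ) ≤ F.card + 1 := by exact_mod_cast h1.trans (by omega)
    linarith
  calc ((Fintype.card Q : ℝ) - 1) * W ≤ F.card * W := by gcongr
    _ = ∑ e ∈ F, W := by simp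
    _ ≤ ∑ e ∈ F, w e := by
        refine Finset.sum_le_sum fun e he => ?_
        have hd := (Finset.mem_filter.1 he).2
        induction e using Sym2.ind with
        | _ u v => exact hW u v (by simpa using hd)
    _ ≤ _ := Finset.sum_le_sum_of_subset_of_nonneg (Finset.filter_subset _ _) fun e _ _ => hw e

/-- Join every point to a representative of its class and every representative to `v₀`, and take a
spanning tree of the result: only the edges of the second kind can cost more than 1. -/
theorem mstCost_le {V Q : Type} [Fintype V] [Nonempty V] [Fintype Q] {w : Sym2 V → ℝ} (q : V → Q)
    (hw : ∀ e, 0 ≤ w e) {W : ℝ} (hW0 : 0 ≤ W) (h1 : ∀ u v, q u = q v → w s(u, v) ≤ 1)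
    (hW : ∀ u v, w s(u, v) ≤ 1 + W) :
    mstCost w ≤ (Fintype.card V : ℝ) - 1 + Fintype.card Q * W := by
  classical
  obtain ⟨v₀⟩ := ‹Nonempty V›
  -- An empty class gets the representative `v₀`, which only contributes a loop.
  set rep : Q → V := fun a => if h : ∃ v, q v = a then h.choose else v₀ with hrep
  have hqrep : ∀ v, q (rep (q v)) = q v := by
    intro v
    have h : ∃ u, q u = q v := ⟨v, rfl⟩
    simp only [hrep, h, dite_true]
    exact h.choose_spec
  set B : Finset (Sym2 V) := Finset.univ.image fun a => s(rep a, v₀) with hB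
  set H : SimpleGraph V := SimpleGraph.fromEdgeSet
    (Set.range (fun v => s(v, rep (q v))) ∪ B) with hH
  have hstep : ∀ u v, s(u, v) ∈ (Set.range (fun v => s(v, rep (q v))) ∪ (B : Set (Sym2 V))) →
      H.Reachable u v := by
    intro u v h
    by_cases huv : u = v
    · rw [huv]
    · exact SimpleGraph.Adj.reachable (by rw [hH, SimpleGraph.fromEdgeSet_adj]; exact ⟨h, huv⟩)
  have hv0 : ∀ v, H.Reachable v v₀ := fun v =>
    (hstep v (rep (q v)) (Or.inl ⟨v, rfl⟩)).trans (hstep (rep (q v)) v₀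
      (Or.inr (Finset.mem_coe.2 (Finset.mem_image.2 ⟨q v, Finset.mem_univ _, rfl⟩))))
  have hconn : H.Connected := by
    have : Nonempty V := ⟨v₀⟩
    exact ⟨fun u v => (hv0 u).trans (hv0 v).symm⟩
  obtain ⟨T, hTH, hT⟩ := hconn.exists_isTree_le
  have hbdd : BddBelow (Set.range fun T : {T : SimpleGraph V // T.IsTree} =>
      ∑ e ∈ T.1.edgeFinset, w e) := by
    refine ⟨0, ?_⟩
    rintro _ ⟨T, rfl⟩
    exact Finset.sum_nonneg fun e _ => hw e
  refine (ciInf_le hbdd ⟨T, hT⟩).trans ?_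
  have hedge : ∀ e ∈ T.edgeFinset, w e ≤ 1 + if e ∈ B then W else 0 := by
    intro e he
    rw [SimpleGraph.mem_edgeFinset] at he
    have he' := SimpleGraph.edgeSet_mono hTH he
    rw [hH, SimpleGraph.edgeSet_fromEdgeSet] at he'
    by_cases hb : e ∈ B
    · rw [if_pos hb]
      induction e using Sym2.ind with
      | _ u v => exact hW u v
    · rw [if_neg hb, add_zero]
      rcases he'.1 with ⟨v, rfl⟩ | h
      · exact h1 _ _ (hqrep v).symm
      · exact absurd h hb
  have hcardT := hT.card_edgeFinset
  have hcardB : B.card ≤ Fintype.card Q := Finset.card_image_le.trans (by simp)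
  calc ∑ e ∈ T.edgeFinset, w e ≤ ∑ e ∈ T.edgeFinset, (1 + if e ∈ B then W else 0) :=
        Finset.sum_le_sum hedge
    _ = T.edgeFinset.card + (T.edgeFinset.filter (· ∈ B)).card * W := by
        rw [Finset.sum_add_distrib, ← Finset.sum_filter]
        simp
    _ ≤ T.edgeFinset.card + Fintype.card Q * W := by
        gcongr
        refine le_trans (Finset.card_le_card fun e he => ?_) hcardB
        exact (Finset.mem_filter.1 he).2
    _ = _ := by
        have : (T.edgeFinset.card : ℝ) + 1 = Fintype.card V := by exact_mod_cast hcardT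
        linarith

/-! ### Metrics with two distances -/

open Classical in
/-- The distance is `1` between points of the same group that satisfies `P`, and `W` between all
other points. -/
noncomputable def groupWeight {V Q : Type} (q : V → Q) (P : Q → Prop) (W : ℝ) (e : Sym2 V) : ℝ :=
  if e.IsDiag then 0 else if (e.map q).IsDiag ∧ ∀ v ∈ e, P (q v) then 1 else W

section GroupWeight

variable {V Q : Type} {q : V → Q} {P : Q → Prop} {W : ℝ}

theorem groupWeight_self (u : V) : groupWeight q P W s(u, u) = 0 := by
  simp [groupWeight]

theorem groupWeight_same {u v : V} (huv : u ≠ v) (h : q u = q v) (hP : P (q u)) :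
    groupWeight q P W s(u, v) = 1 := by
  have : P (q v) := h ▸ hP
  unfold groupWeight
  rw [if_neg (by simpa using huv), if_pos]
  simp [h, this]

theorem groupWeight_other {u v : V} (huv : u ≠ v) (h : ¬ (q u = q v ∧ P (q u))) :
    groupWeight q P W s(u, v) = W := by
  unfold groupWeight
  rw [if_neg (by simpa using huv), if_neg]
  simp only [Sym2.map_mk, Sym2.mk_isDiag_iff, Sym2.mem_iff, forall_eq_or_imp, forall_eq]
  tauto

theorem groupWeight_cases (q : V → Q) (P : Q → Prop) (W : ℝ) {e : Sym2 V} (he : ¬ e.IsDiag) :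
    groupWeight q P W e = 1 ∨ groupWeight q P W e = W := by
  unfold groupWeight
  rw [if_neg he]
  split_ifs <;> simp

theorem groupWeight_nonneg (q : V → Q) (P : Q → Prop) (hW : 1 ≤ W) (e : Sym2 V) :
    0 ≤ groupWeight q P W e := by
  unfold groupWeight
  split_ifs <;> linarith

/-- The triangle inequality could only fail for a long side with two sides of length 1, and distance
1 is transitive. -/
theorem groupWeight_isMetricWeight (q : V → Q) (P : Q → Prop) (hW : 1 ≤ W) :
    IsMetricWeight (groupWeight q P W) := by
  have hone : ∀ u v, u ≠ v → 1 ≤ groupWeight q P W s(u, v) := by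
    intro u v huv
    rcases groupWeight_cases q P W (e := s(u, v)) (by simpa using huv) with h | h <;> rw [h]
    exact hW
  refine ⟨groupWeight_self, fun u v huv => by linarith [hone u v huv], fun u v t => ?_⟩
  by_cases hut : u = t
  · subst hut
    rw [groupWeight_self]
    linarith [groupWeight_nonneg q P hW s(u, v), groupWeight_nonneg q P hW s(v, u)]
  by_cases huv : u = v
  · subst huv
    rw [groupWeight_self, zero_add]
  by_cases hvt : v = t
  · subst hvt
    rw [groupWeight_self, add_zero]
  have h1 := hone u v huv
  have h2 := hone v t hvt
  by_cases ha : q u = q v ∧ P (q u)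
  · by_cases hb : q v = q t ∧ P (q v)
    · rw [groupWeight_same hut (ha.1.trans hb.1) ha.2]
      linarith
    · rw [groupWeight_other hvt hb]
      rcases groupWeight_cases q P W (e := s(u, t)) (by simpa using hut) with h | h <;> linarith
  · rw [groupWeight_other huv ha]
    rcases groupWeight_cases q P W (e := s(u, t)) (by simpa using hut) with h | h <;> linarith

theorem mstCost_groupWeight_le [Fintype V] [Nonempty V] [Fintype Q] (q : V → Q) (hW : 1 ≤ W) :
    mstCost (groupWeight q (fun _ => True) W) ≤
      (Fintype.card V : ℝ) - 1 + Fintype.card Q * W := by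
  refine mstCost_le q (groupWeight_nonneg _ _ hW) (by linarith) (fun u v h => ?_) fun u v => ?_
  · by_cases huv : u = v
    · rw [huv, groupWeight_self]; norm_num
    · rw [groupWeight_same huv h trivial]
  · by_cases huv : u = v
    · rw [huv, groupWeight_self]; linarith
    · rcases groupWeight_cases q (fun _ => True) W (e := s(u, v)) (by simpa using huv) with h | h <;>
        linarith

theorem le_mstCost_groupWeight [Fintype V] [Nonempty V] (q : V → Q) (P : Q → Prop) (hW : 1 ≤ W)
    {a : Q} (ha : ¬ P a) (hne : {v | q v = a}.Nonempty) :
    (({v | q v = a}.ncard : ℝ) - 1) * W ≤ mstCost (groupWeight q P W) := by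
  classical
  obtain ⟨i₀, hi₀⟩ := hne
  have hcard : {v | q v = a}.ncard = Fintype.card {v // q v = a} := by
    rw [← Nat.card_coe_set_eq, ← Nat.card_eq_fintype_card]
    rfl
  rw [hcard]
  -- Points of group `a` stay separate and all others are merged with `i₀`. Points in different
  -- classes then include one of group `a`, which is at distance `W` from everything else.
  refine le_mstCost (q := fun v => if h : q v = a then (⟨v, h⟩ : {v // q v = a}) else ⟨i₀, hi₀⟩)
    (fun v => ⟨v.1, by simp [v.2]⟩) (groupWeight_nonneg _ _ hW) (by linarith) fun u v h => ?_
  rw [groupWeight_other]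
  · rintro rfl
    exact h rfl
  · rintro ⟨h1, h2⟩
    have hu : q u ≠ a := fun h' => ha (h' ▸ h2)
    have hv : q v ≠ a := h1 ▸ hu
    simp [hu, hv] at h

end GroupWeight

theorem groupWeight_isStreamMetric {n : ℕ} {Q : Type} {q : Fin n → Q} {P : Q → Prop} {α : ℝ}
    (h : 1 ≤ α * n) {e : Sym2 (Fin n)} (he : ¬ e.IsDiag) :
    ∃ a : ℕ, 1 ≤ a ∧ (a : ℝ) ≤ α * n ∧ groupWeight q P ⌊α * n⌋₊ e = a := by
  rcases groupWeight_cases q P (⌊α * n⌋₊ : ℝ) he with h' | h'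
  · exact ⟨1, le_rfl, by simpa using h, by rw [h']; simp⟩
  · exact ⟨⌊α * n⌋₊, Nat.le_floor (by simpa using h), Nat.floor_le (by linarith), h'⟩

/-- The decision whether the estimate is at most `thr` is correct with probability `1 - δ` if the
minimum spanning tree costs at most `thr`. -/
theorem RandStreamAlg.ApproximatesMST.prob_le {n S p : ℕ} {A : RandStreamAlg n S} {α δ : ℝ}
    (hA : A.ApproximatesMST p α δ) {w : Sym2 (Fin n) → ℝ} (hw : IsMetricWeight w)
    (hint : ∀ e, ¬ e.IsDiag → ∃ a : ℕ, 1 ≤ a ∧ (a : ℝ) ≤ α * n ∧ w e = a)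
    {s : List (StreamItem n)} (hs : IsMetricStream w s) {thr : ℝ} (hthr : mstCost w ≤ thr) :
    1 - δ ≤ A.P.real {ω | decide ((A.alg ω).output p s ≤ thr) = true} := by
  have := A.prob
  refine (hA w hw hint s hs).trans (measureReal_mono fun ω h => ?_)
  simpa using h.1.trans hthr

theorem RandStreamAlg.ApproximatesMST.prob_gt {n S p : ℕ} {A : RandStreamAlg n S} {α δ : ℝ}
    (hα : 0 < α)
    (hA : A.ApproximatesMST p α δ) {w : Sym2 (Fin n) → ℝ} (hw : IsMetricWeight w)
    (hint : ∀ e, ¬ e.IsDiag → ∃ a : ℕ, 1 ≤ a ∧ (a : ℝ) ≤ α * n ∧ w e = a)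
    {s : List (StreamItem n)} (hs : IsMetricStream w s) {thr : ℝ} (hthr : α * thr < mstCost w) :
    1 - δ ≤ A.P.real {ω | decide ((A.alg ω).output p s ≤ thr) = false} := by
  have := A.prob
  refine (hA w hw hint s hs).trans (measureReal_mono fun ω h => ?_)
  simpa using lt_of_mul_lt_mul_left (hthr.trans_le h.2) hα.le

theorem RandStreamAlg.measurable_decide {n S : ℕ} (A : RandStreamAlg n S) (p : ℕ)
    (s : List (StreamItem n)) (thr : ℝ) :
    Measurable[A.mΩ] fun ω => decide ((A.alg ω).output p s ≤ thr) := by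
  let _ := A.mΩ
  refine measurable_to_bool ?_
  have : (fun ω => decide ((A.alg ω).output p s ≤ thr)) ⁻¹' {true} =
      (fun ω => (A.alg ω).output p s) ⁻¹' Set.Iic thr := by
    ext ω
    simp
  rw [this]
  exact A.measurable_output p s measurableSet_Iic

/-- A streaming algorithm without memory does not approximate the cost of a minimum spanning
tree. -/
theorem one_le_of_approximatesMST {n p S : ℕ} {α δ : ℝ} (hα : 1 < α) (hn : 2 ≤ n)
    (hδ : δ < 1 / 2) (A : RandStreamAlg n S) (hA : A.ApproximatesMST p α δ) : 1 ≤ S := by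
  by_contra! hS
  obtain rfl : S = 0 := by omega
  let _ := A.mΩ
  have := A.prob
  have : Nonempty (Fin n) := ⟨⟨0, by omega⟩⟩
  have hn' : (2 : ℝ) ≤ n := by exact_mod_cast hn
  have hαn : 1 ≤ α * n := by nlinarith
  set W : ℝ := ((⌊α * n⌋₊ : ℕ) : ℝ) with hWdef
  have hWα : α < W := by
    have := Nat.lt_floor_add_one (α * n)
    nlinarith
  have hstream : ∀ w : Sym2 (Fin n) → ℝ, ∃ s, IsMetricStream w s := by
    classical
    intro w
    refine ⟨(Finset.univ.filter fun e : Sym2 (Fin n) => ¬ e.IsDiag).toList.map fun e => (e, w e),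
      fun x hx => ?_, fun e he => ?_⟩
    · obtain ⟨e, he, rfl⟩ := List.mem_map.1 hx
      simpa using he
    · exact List.mem_map.2 ⟨e, by simpa using he, rfl⟩
  set w1 := groupWeight (fun _ : Fin n => ()) (fun _ => True) W
  set w2 := groupWeight (fun _ : Fin n => ()) (fun _ => False) W
  obtain ⟨s1, hs1⟩ := hstream w1
  obtain ⟨s2, hs2⟩ := hstream w2
  have hm1 : mstCost w1 ≤ (n : ℝ) - 1 := by
    -- All distances are 1, so `W = 0` is admissible and removes the term for the number of classes.
    have := mstCost_le (w := w1) (W := 0) (fun _ : Fin n => ())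
      (groupWeight_nonneg _ _ (by linarith)) le_rfl (fun u v _ => ?_) fun u v => ?_
    · simpa using this
    all_goals
      by_cases huv : u = v
      · rw [huv]
        simp [w1, groupWeight_self]
      · simp [w1, groupWeight_same huv]
  have hm2 : α * ((n : ℝ) - 1) < mstCost w2 := by
    have huniv : {v : Fin n | () = ()} = Set.univ := by simp
    have := le_mstCost_groupWeight (W := W) (fun _ : Fin n => ()) (fun _ => False) (by linarith)
      (a := ()) (by simp) (by rw [huniv]; exact Set.univ_nonempty)
    rw [huniv, Set.ncard_univ, Nat.card_fin] at this
    refine lt_of_lt_of_le ?_ this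
    rw [mul_comm]
    exact mul_lt_mul_of_pos_left hWα (by linarith)
  obtain ⟨ω, hω⟩ := exists_sum_le_sum_indicator (J := Unit) A.P
    (fun _ ω => decide ((A.alg ω).output p s1 ≤ n - 1))
    (fun _ ω => decide ((A.alg ω).output p s2 ≤ n - 1))
    (fun _ => A.measurable_decide p s1 _) (fun _ => A.measurable_decide p s2 _) δ
    (fun _ => hA.prob_le (groupWeight_isMetricWeight _ _ (by linarith))
      (fun e he => groupWeight_isStreamMetric hαn he) hs1 hm1)
    (fun _ => hA.prob_gt (by linarith) (groupWeight_isMetricWeight _ _ (by linarith))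
      (fun e he => groupWeight_isStreamMetric hαn he) hs2 hm2)
  have hconst : (A.alg ω).output p s1 = (A.alg ω).output p s2 := by
    unfold StreamAlg.output
    rw [Subsingleton.elim ((A.alg ω).memAfter s1 p)]
  rw [hconst] at hω
  simp at hω
  linarith

/-! ### From clique or independent set to metric streams -/

section Reduction

variable {n : ℕ} {V : Type}

/-- The group of a point of the stream, where the points outside the image of `V` form a group of
their own. -/
noncomputable def extendGroup {Q : Type} (emb : V ↪ Fin n) (φ : V → Q) : Fin n → Option Q :=
  Function.extend emb (fun v => some (φ v)) fun _ => none

theorem extendGroup_apply {Q : Type} (emb : V ↪ Fin n) (φ : V → Q) (v : V) :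
    extendGroup emb φ (emb v) = some (φ v) := emb.injective.extend_apply _ _ _

theorem extendGroup_of_notMem {Q : Type} (emb : V ↪ Fin n) (φ : V → Q) {u : Fin n}
    (hu : u ∉ Set.range emb) : extendGroup emb φ u = none :=
  Function.extend_apply' _ _ _ hu

open Classical in
/-- The entry that a player with input `y` contributes for the pair `e`; for a pair that the player
does not know, it is the entry of the pair `d`. -/
noncomputable def streamEntry (emb : V ↪ Fin n) (W : ℝ) (d : Sym2 (Fin n)) (y : PairInfo V)
    (e : Sym2 (Fin n)) : StreamItem n :=
  if ¬ e.IsDiag ∧ ∀ e', e = e'.map emb → e' ∈ y.known then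
    (e, if (∃ e' ∈ y.edges, e = e'.map emb) ∨ ∀ v ∈ e, v ∉ Set.range emb then 1 else W)
  else (d, 1)

/-- The part of the stream that a player with input `y` contributes. -/
noncomputable def streamPiece (emb : V ↪ Fin n) (W : ℝ) (d : Sym2 (Fin n)) (y : PairInfo V) :
    List (StreamItem n) :=
  Finset.univ.toList.map (streamEntry emb W d y)

theorem length_streamPiece (emb : V ↪ Fin n) (W : ℝ) (d : Sym2 (Fin n)) (y : PairInfo V) :
    (streamPiece emb W d y).length = Fintype.card (Sym2 (Fin n)) := by
  simp [streamPiece]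

theorem boardGraph_adj_iff_mem {k : ℕ} {x : Fin k → PairInfo V} (hx : IsValidInfo x)
    {i : Fin k} {u v : V} (huv : u ≠ v) (hi : s(u, v) ∈ (x i).known) :
    (boardGraph x).Adj u v ↔ s(u, v) ∈ (x i).edges := by
  rw [boardGraph, SimpleGraph.fromEdgeSet_adj, Set.mem_iUnion]
  constructor
  · rintro ⟨⟨j, hj⟩, -⟩
    exact hx.2 j i _ ⟨(x j).edges_subset hj, hi⟩ hj
  · exact fun h => ⟨⟨i, h⟩, huv⟩

/-- A pair not inside the image of `emb` is vacuously known to every player, and its distance does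
not depend on the input. An unknown pair is replaced by the entry of `s(x₀, x₁)`, which is always 1
as the leftover points form a group with `P none`; this padding keeps all pieces equally long. -/
theorem isMetricStream_flatMap {Q : Type} {k : ℕ} (hk : 0 < k) (emb : V ↪ Fin n) (W : ℝ)
    {x₀ x₁ : Fin n} (h01 : x₀ ≠ x₁) (h0 : x₀ ∉ Set.range emb) (h1 : x₁ ∉ Set.range emb)
    {x : Fin k → PairInfo V} (hx : IsValidInfo x) (φ : V → Q) {P : Option Q → Prop} (hP : P none)
    (hadj : ∀ u v, (boardGraph x).Adj u v ↔ u ≠ v ∧ φ u = φ v ∧ P (some (φ u))) :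
    IsMetricStream (groupWeight (extendGroup emb φ) P W)
      ((List.finRange k).flatMap fun i => streamPiece emb W s(x₀, x₁) (x i)) := by
  classical
  have hentry : ∀ i (e : Sym2 (Fin n)), ¬ e.IsDiag → (∀ e', e = e'.map emb → e' ∈ (x i).known) →
      streamEntry emb W s(x₀, x₁) (x i) e = (e, groupWeight (extendGroup emb φ) P W e) := by
    intro i e he hknown
    unfold streamEntry
    rw [if_pos ⟨he, hknown⟩]
    refine Prod.ext rfl ?_
    induction e using Sym2.ind with
    | _ u v =>
      have huv : u ≠ v := by simpa using he
      by_cases hu : u ∈ Set.range emb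
      · obtain ⟨a, rfl⟩ := hu
        have hnot : ¬ ∀ w ∈ s(emb a, v), w ∉ Set.range emb := fun h =>
          h (emb a) (by simp) ⟨a, rfl⟩
        by_cases hv : v ∈ Set.range emb
        · obtain ⟨b, rfl⟩ := hv
          have hab : a ≠ b := fun h => huv (by rw [h])
          have hmem : (∃ e' ∈ (x i).edges, s(emb a, emb b) = e'.map emb) ↔
              s(a, b) ∈ (x i).edges := by
            constructor
            · rintro ⟨e', he', h⟩
              have : s(a, b) = e' := Sym2.map.injective emb.injective h
              rwa [this]
            · exact fun h => ⟨_, h, rfl⟩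
          have hgr := (boardGraph_adj_iff_mem hx hab (hknown s(a, b) rfl)).symm.trans (hadj a b)
          by_cases hE : s(a, b) ∈ (x i).edges
          · rw [if_pos (Or.inl (hmem.2 hE)), groupWeight_same huv]
            · rw [extendGroup_apply, extendGroup_apply, (hgr.1 hE).2.1]
            · rw [extendGroup_apply]
              exact (hgr.1 hE).2.2
          · rw [if_neg (by rw [hmem]; exact fun h => h.elim hE hnot), groupWeight_other huv]
            rw [extendGroup_apply, extendGroup_apply, Option.some_inj]
            exact fun h => hE (hgr.2 ⟨hab, h⟩)
        · rw [if_neg, groupWeight_other huv]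
          · rw [extendGroup_apply, extendGroup_of_notMem _ _ hv]
            simp
          · rintro (⟨e', -, h⟩ | h)
            · have : v ∈ e'.map emb := h ▸ (by simp)
              obtain ⟨b, -, rfl⟩ := Sym2.mem_map.1 this
              exact hv ⟨b, rfl⟩
            · exact hnot h
      · by_cases hv : v ∈ Set.range emb
        · rw [if_neg, groupWeight_other huv]
          · obtain ⟨b, rfl⟩ := hv
            rw [extendGroup_apply, extendGroup_of_notMem _ _ hu]
            simp
          · rintro (⟨e', -, h⟩ | h)
            · have : u ∈ e'.map emb := h ▸ (by simp)
              obtain ⟨b, -, rfl⟩ := Sym2.mem_map.1 this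
              exact hu ⟨b, rfl⟩
            · exact h v (by simp) hv
        · rw [if_pos, groupWeight_same huv]
          · rw [extendGroup_of_notMem _ _ hu, extendGroup_of_notMem _ _ hv]
          · rwa [extendGroup_of_notMem _ _ hu]
          · right
            intro w hw
            rcases Sym2.mem_iff.1 hw with rfl | rfl <;> assumption
  constructor
  · intro z hz
    obtain ⟨i, -, hi⟩ := List.mem_flatMap.1 hz
    obtain ⟨e, -, rfl⟩ := List.mem_map.1 hi
    by_cases h : ¬ e.IsDiag ∧ ∀ e', e = e'.map emb → e' ∈ (x i).known
    · rw [hentry i e h.1 h.2]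
      exact ⟨h.1, rfl⟩
    · unfold streamEntry
      rw [if_neg h]
      refine ⟨by simpa using h01, ?_⟩
      rw [groupWeight_same h01]
      · rw [extendGroup_of_notMem _ _ h0, extendGroup_of_notMem _ _ h1]
      · rwa [extendGroup_of_notMem _ _ h0]
  · intro e he
    obtain ⟨i, hi⟩ : ∃ i, ∀ e', e = e'.map emb → e' ∈ (x i).known := by
      by_cases h : ∃ e' : Sym2 V, e = e'.map emb
      · obtain ⟨e', rfl⟩ := h
        obtain ⟨i, hi⟩ := hx.1 e' fun h' => he (by
          induction e' using Sym2.ind with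
          | _ u v =>
            have : u = v := by simpa using h'
            simp [this])
        refine ⟨i, fun e'' h'' => ?_⟩
        rwa [← Sym2.map.injective emb.injective h'']
      · exact ⟨⟨0, hk⟩, fun e' h' => absurd ⟨e', h'⟩ h⟩
    rw [← hentry i e he hi]
    exact List.mem_flatMap.2 ⟨i, List.mem_finRange i,
      List.mem_map.2 ⟨e, Finset.mem_toList.2 (Finset.mem_univ e), rfl⟩⟩

end Reduction

/-- A vertex of the independent set has no neighbour, but in a clique of size at least 2 it would
have one. -/
theorem not_isCliqueUnionWithIndep {V : Type} [Finite V] {N m : ℕ} (hN : 2 ≤ N)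
    {G : SimpleGraph V} (h : IsCliqueUnion N m G) : ¬ IsCliqueUnionWithIndep N m G := by
  rintro ⟨φ, a, hφ, hadj⟩
  obtain ⟨ψ, hψ, hadj'⟩ := h
  obtain ⟨u, hu⟩ : {v | φ v = a}.Nonempty := by
    rw [← Set.ncard_pos, hφ]
    omega
  obtain ⟨v, hv, hvu⟩ := Set.exists_ne_of_one_lt_ncard (s := {v | ψ v = ψ u})
    (by rw [hψ]; omega) u
  exact ((hadj u v).1 ((hadj' u v).2 ⟨hvu.symm, Eq.symm hv⟩)).2.2 hu

/-- An approximation of the cost of a minimum spanning tree solves the clique or independent set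
problem. -/
theorem exists_protocol_of_approximatesMST {n p S k N m : ℕ} {α δ : ℝ} (hα : 1 < α)
    (hδ : 0 < δ) (hk : 0 < k) (hN : 2 ≤ N) (hm : 1 ≤ m)
    (A : RandStreamAlg n S) (hA : A.ApproximatesMST p α δ) (hnm : N * m + 2 ≤ n)
    (hαN : 2 * α * m + 3 < N) :
    ∃ π : RandBoardProtocol k (PairInfo (Fin m × Fin N)), SolvesCOI N m δ π ∧
      π.CommAtMost (p * k * S) := by
  classical
  have hn2 : 2 ≤ n := by omega
  have hn' : (2 : ℝ) ≤ n := by exact_mod_cast hn2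
  have : Nonempty (Fin n) := ⟨⟨0, by omega⟩⟩
  -- The two points beyond `N * m` provide the padding entry.
  obtain ⟨emb, x₀, x₁, h01, h0, h1⟩ : ∃ (emb : Fin m × Fin N ↪ Fin n) (x₀ x₁ : Fin n),
      x₀ ≠ x₁ ∧ x₀ ∉ Set.range emb ∧ x₁ ∉ Set.range emb := by
    have hlt : ∀ v : Fin m × Fin N, (finProdFinEquiv v).val < N * m := fun v =>
      (finProdFinEquiv v).isLt.trans_eq (mul_comm _ _)
    refine ⟨⟨fun v => ⟨(finProdFinEquiv v).val, by have := hlt v; omega⟩, fun u v h => ?_⟩,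
      ⟨N * m, by omega⟩, ⟨N * m + 1, by omega⟩, ?_, ?_, ?_⟩
    · exact finProdFinEquiv.injective (Fin.ext (Fin.mk.inj_iff.1 h))
    · simp
    · rintro ⟨v, hv⟩
      have h := hlt v
      have h' : (finProdFinEquiv v).val = N * m := Fin.mk.inj_iff.1 hv
      omega
    · rintro ⟨v, hv⟩
      have h := hlt v
      have h' : (finProdFinEquiv v).val = N * m + 1 := Fin.mk.inj_iff.1 hv
      omega
  have hαn : 1 ≤ α * n := by nlinarith
  set W : ℝ := ((⌊α * n⌋₊ : ℕ) : ℝ) with hW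
  have hW1 : 1 ≤ W := by
    have : 1 ≤ ⌊α * n⌋₊ := Nat.le_floor (by simpa using hαn)
    rw [hW]
    exact_mod_cast this
  have hWn : α * n < W + 1 := Nat.lt_floor_add_one _
  -- The upper bound on the tree in the Yes case: `m` cliques and the group of leftover points.
  set thr : ℝ := (n : ℝ) - 1 + (m + 1) * W with hthr
  obtain ⟨prot, hbits, hout⟩ := A.exists_protocol (k := k) p thr
    (streamPiece emb W s(x₀, x₁)) (length_streamPiece emb W s(x₀, x₁))
  let _ := A.mΩ
  have := A.prob
  -- Here `α * n < W + 1` and `1 < α` bound `α * (n - 1)` by `W`, and `α * (m + 1) ≤ 2 * α * m` uses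
  -- `1 ≤ m`.
  have hgap : α * thr < (N - 1) * W := by
    have hm1 : (1 : ℝ) ≤ m := by exact_mod_cast hm
    have h1 : α * thr < W + α * (m + 1) * W := by
      have : α * thr = α * n - α + α * (m + 1) * W := by rw [hthr]; ring
      linarith
    have h2 : 1 + α * (m + 1) ≤ N - 1 := by nlinarith
    calc α * thr < (1 + α * (m + 1)) * W := by linarith
      _ ≤ (N - 1) * W := by gcongr
  refine ⟨⟨A.Ω, A.P, prot, fun x => ?_⟩, fun x => ?_, fun ω x => (hbits ω x).le⟩
  · simp only [hout]
    exact A.measurable_decide p _ thr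
  · have htriv : (∀ b, COICorrect N m x b) →
        1 - δ ≤ A.P.real {ω | COICorrect N m x ((prot ω).output x)} := by
      intro h
      simp only [h, Set.ofPred_true, probReal_univ]
      linarith
    by_cases hx : IsValidInfo x
    · by_cases hY : IsCliqueUnion N m (boardGraph x)
      · obtain ⟨φ, hφ, hadj⟩ := id hY
        have hs := isMetricStream_flatMap hk emb W h01 h0 h1 hx φ (P := fun _ => True) trivial
          (by simpa using hadj)
        have hmst := mstCost_groupWeight_le (extendGroup emb φ) hW1
        rw [Fintype.card_fin, Fintype.card_option, Fintype.card_fin] at hmst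
        push_cast at hmst
        refine (hA.prob_le (groupWeight_isMetricWeight _ _ hW1)
          (fun e he => groupWeight_isStreamMetric hαn he) hs hmst).trans
          (measureReal_mono fun ω h _ => ⟨fun _ => ?_, fun h' =>
            absurd h' (not_isCliqueUnionWithIndep hN hY)⟩)
        rw [hout]
        exact h
      · by_cases hNo : IsCliqueUnionWithIndep N m (boardGraph x)
        · obtain ⟨φ, a, hφ, hadj⟩ := id hNo
          have hs := isMetricStream_flatMap hk emb W h01 h0 h1 hx φ
            (P := fun q => q ≠ some a) (by simp) (by simpa using hadj)
          have hset : {v | extendGroup emb φ v = some a} = emb '' {v | φ v = a} := by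
            ext v
            constructor
            · intro hv
              by_cases hr : v ∈ Set.range emb
              · obtain ⟨b, rfl⟩ := hr
                refine ⟨b, ?_, rfl⟩
                simpa [extendGroup_apply] using hv
              · simp [extendGroup_of_notMem _ _ hr] at hv
            · rintro ⟨b, hb, rfl⟩
              simpa [extendGroup_apply] using hb
          have hcard : {v | extendGroup emb φ v = some a}.ncard = N := by
            rw [hset, Set.ncard_image_of_injective _ emb.injective, hφ]
          have hmst := le_mstCost_groupWeight (extendGroup emb φ) (fun q => q ≠ some a) hW1
            (a := some a) (by simp) (by
              rw [← Set.ncard_pos, hcard]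
              omega)
          rw [hcard] at hmst
          refine (hA.prob_gt (by linarith) (groupWeight_isMetricWeight _ _ hW1)
            (fun e he => groupWeight_isStreamMetric hαn he) hs (hgap.trans_le hmst)).trans
            (measureReal_mono fun ω h _ => ⟨fun h' => absurd h' hY, fun _ => ?_⟩)
          rw [hout]
          exact h
        · exact htriv fun b _ => ⟨fun h => absurd h hY, fun h => absurd h hNo⟩
    · exact htriv fun b h => absurd h hx

/-! ### Choice of parameters for the streaming bound -/

theorem streaming_lower_bound {δ : ℝ} (hδ0 : 0 < δ) (hδ : δ < 1 / 2) {α : ℝ} (hα : 1 < α)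
    {n p S : ℕ} (hn : 2 ≤ n) (hp : 1 ≤ p) (A : RandStreamAlg n S) (hA : A.ApproximatesMST p α δ) :
    (1 - 2 * δ) ^ 2 / 6144 / 192 * Real.sqrt ((n : ℝ) / (α * (p : ℝ) ^ 2)) / Real.log n ^ 4 ≤
      (S : ℝ) := by
  have hp' : (1 : ℝ) ≤ p := by exact_mod_cast hp
  have hα0 : 0 < α := by linarith
  have hS1 : (1 : ℝ) ≤ S := by exact_mod_cast one_le_of_approximatesMST hα hn hδ A hA
  have hn' : (2 : ℝ) ≤ n := by exact_mod_cast hn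
  have hlog2 : 1 / 2 ≤ Real.log 2 := by linarith [Real.log_two_gt_d9]
  have hlogn : Real.log 2 ≤ Real.log n := Real.log_le_log (by norm_num) hn'
  have hl : 1 / 2 ≤ Real.log n := hlog2.trans hlogn
  have hl4 : 1 / 16 ≤ Real.log n ^ 4 := by
    calc (1 : ℝ) / 16 = (1 / 2) ^ 4 := by norm_num
      _ ≤ _ := by gcongr
  have hγ : (1 - 2 * δ) ^ 2 ≤ 1 := by nlinarith
  have hγ0 : 0 ≤ (1 - 2 * δ) ^ 2 := sq_nonneg _
  set c := (1 - 2 * δ) ^ 2 / 6144 with hc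
  have hc0 : 0 ≤ c := by positivity
  have hc1 : c ≤ 1 / 6144 := by rw [hc]; linarith
  have hsq : Real.sqrt ((n : ℝ) / (α * (p : ℝ) ^ 2)) = √(n / α) / p := by
    rw [← div_div, Real.sqrt_div (by positivity), Real.sqrt_sq (by linarith)]
  rw [hsq, div_le_iff₀ (by positivity)]
  set R := √((n : ℝ) / α) with hR
  have hR0 : 0 ≤ R := Real.sqrt_nonneg _
  have hR2 : R ^ 2 * α = n := by
    rw [hR, Real.sq_sqrt (by positivity)]
    field_simp
  -- For `R < 3` the claimed bound is below 1, and `1 ≤ S` suffices.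
  rcases lt_or_ge R 3 with h3 | h3
  · have h1 : R / p ≤ 3 := (div_le_self hR0 hp').trans h3.le
    have h2 : c / 192 * (R / p) ≤ 1 / 6144 / 192 * 3 := by gcongr
    have h4 : (1 : ℝ) * (1 / 16) ≤ S * Real.log n ^ 4 := by gcongr
    linarith
  · set m := ⌊R / 3⌋₊ with hm
    have hm1 : 1 ≤ m := Nat.le_floor (by push_cast; linarith)
    have hmR : (m : ℝ) ≤ R / 3 := Nat.floor_le (by positivity)
    have hmR' : R / 3 < m + 1 := Nat.lt_floor_add_one _
    have hm1' : (1 : ℝ) ≤ m := by exact_mod_cast hm1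
    -- The least simple choice above `2 * α * m + 3`. It fits into `n` points since `N * m ≤ 6 * α *
    -- m ^ 2 ≤ (2 / 3) * n` and `n ≥ 9 * α`.
    set N := ⌊2 * α * m⌋₊ + 4 with hNdef
    have hNle : (N : ℝ) ≤ 2 * α * m + 4 := by
      rw [hNdef]
      push_cast
      linarith [Nat.floor_le (show (0 : ℝ) ≤ 2 * α * m by positivity)]
    have hNgt : 2 * α * m + 3 < N := by
      rw [hNdef]
      push_cast
      linarith [Nat.lt_floor_add_one (2 * α * m)]
    have hnm : N * m + 2 ≤ n := by
      have h1 : (N : ℝ) * m + 2 ≤ n := by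
        have h2 : (N : ℝ) * m ≤ (2 * α * m + 4) * m := by gcongr
        have h3 : (m : ℝ) ^ 2 * α ≤ (R / 3) ^ 2 * α := by gcongr
        have h4 : (m : ℝ) * m ≤ α * m * m := by nlinarith
        nlinarith
      exact_mod_cast h1
    have hN2 : 2 ≤ N := by omega
    have hl1 := one_le_logb_two hN2
    obtain ⟨π, hπ, hC⟩ := exists_protocol_of_approximatesMST (k := ⌊2 * Real.logb 2 N⌋₊) hα hδ0
      (Nat.floor_pos.2 (by linarith)) hN2 hm1 A hA hnm hNgt
    have hmain := coi_communication hδ0 hδ hN2 hm1 π hπ hC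
    rw [← hc, div_le_iff₀ (by positivity)] at hmain
    push_cast at hmain
    have hk : ((⌊2 * Real.logb 2 N⌋₊ : ℕ) : ℝ) ≤ 2 * Real.logb 2 N := Nat.floor_le (by positivity)
    have hLn : Real.logb 2 N ≤ 2 * Real.log n := by
      have hNn : N ≤ n := (Nat.le_mul_of_pos_right N hm1).trans (by omega)
      have h1 : Real.log N ≤ Real.log n :=
        Real.log_le_log (by positivity) (by exact_mod_cast hNn)
      rw [Real.logb, div_le_iff₀ (by linarith)]
      have h2 := mul_le_mul_of_nonneg_left hlog2 (show 0 ≤ Real.log n by linarith)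
      linarith
    have h5 : c * m ≤ p * (2 * Real.logb 2 N) * S * Real.logb 2 N ^ 3 := by
      refine hmain.trans ?_
      gcongr
    have h6 : c * m ≤ 32 * (p * S * Real.log n ^ 4) := by
      calc c * m ≤ 2 * (p * S) * Real.logb 2 N ^ 4 := by linarith
        _ ≤ 2 * (p * S) * (2 * Real.log n) ^ 4 := by gcongr
        _ = _ := by ring
    -- From `R / 3 < m + 1 ≤ 2 * m`. Together with the 32 of `h6` this makes up the constant `192 =
    -- 6 * 32`.
    have h7 : c * R ≤ 6 * (c * m) := by nlinarith
    rw [mul_div_assoc', div_le_iff₀ (by linarith)]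
    linarith

theorem mainTheorem5 :
    (∃ κ : ℕ, ∀ δ : ℝ, 0 < δ → δ < 1 / 2 → ∃ c : ℝ, 0 < c ∧
      ∀ α : ℝ, 1 < α → ∀ n p S : ℕ, 2 ≤ n → 1 ≤ p →
        ∀ A : RandStreamAlg n S, A.ApproximatesMST p α δ →
          c * Real.sqrt ((n : ℝ) / (α * (p : ℝ) ^ 2)) / Real.log n ^ κ ≤ (S : ℝ)) ∧
    (∀ δ : ℝ, 0 < δ → δ < 1 / 2 → ∃ c : ℝ, 0 < c ∧
      ∀ N m : ℕ, 2 ≤ N → 1 ≤ m →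
        ∀ π : RandBoardProtocol ⌊2 * Real.logb 2 N⌋₊ (PairInfo (Fin m × Fin N)),
          SolvesCOI N m δ π → ∀ C : ℕ, π.CommAtMost C →
            c * (m : ℝ) / Real.logb 2 N ^ 3 ≤ (C : ℝ)) := by
  have hpos : ∀ δ : ℝ, δ < 1 / 2 → 0 < (1 - 2 * δ) ^ 2 := fun δ hδ => by
    have : 0 < 1 - 2 * δ := by linarith
    positivity
  -- Three logarithms come from the clique problem and the fourth from the number of players in the
  -- simulation.
  refine ⟨⟨4, fun δ hδ0 hδ => ⟨(1 - 2 * δ) ^ 2 / 6144 / 192, ?_,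
    fun α hα n p S hn hp A hA => streaming_lower_bound hδ0 hδ hα hn hp A hA⟩⟩,
    fun δ hδ0 hδ => ⟨(1 - 2 * δ) ^ 2 / 6144, ?_,
      fun N m hN hm π hπ C hC => coi_communication hδ0 hδ hN hm π hπ hC⟩⟩
  · have := hpos δ hδ
    positivity
  · have := hpos δ hδ
    positivity
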